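/- Let $n,k\ge 1$. A preference model on $n$ items is a map $M:\Delta(n)\to[0,1]^n$ on the probability simplex; write $M^*_v=\sum_i M(v)_i$. For a menu $K\subseteq[n]$ with $|K|=k$ let $p_{K,v}$ be the distribution on $K$ with $p_{K,v,i}=M(v)_i/\sum_{j\in K}M(v)_j$. Let $\mathrm{IRD}(v,M)$ be the convex hull of the $p_{K,v}$ over all $K$ with $|K|=k$, and for a class $\mathcal M$ of models let $\mathrm{EIRD}(\mathcal M)=\bigcap_{M\in\mathcal M}\bigcap_{v\in\Delta(n)}\mathrm{IRD}(v,M)\subseteq\Delta(n)$. For $v^*\in\Delta(n)$ and $\alpha>0$ let $V_\alpha=\{v\in\mathbb R^n:\sum_i v_i=1,\ \|v-v^*\|_2\le\alpha\}$. Say that $\mathcal M$ is $h$-locally learnable around $v^*$ for $\beta\le B(\varepsilon,\alpha)$ if $v^*\in\mathrm{EIRD}(\mathcal M)$, $V_\alpha\subseteq\mathrm{EIRD}(\mathcal M)$ for some $\alpha>0$, and for all $\alpha>0$ with $V_\alpha\subseteq\mathrm{EIRD}(\mathcal M)$, all $\varepsilon>0$ and all $0\le\beta\le B(\varepsilon,\alpha)$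 there is a (possibly adaptive) algorithm making at most $h$ queries, all at points of $V_\alpha$, such that for every $M\in\mathcal M$: if each query $v$ is answered by some $\hat s_v\in\mathbb R^n$ with $\|\hat s_v-M(v)/M^*_v\|_\infty\le\beta$, then it outputs a preference model $\hat M$ with $\hat M^*_x>0$ and $\|\hat M(x)/\hat M^*_x-M(x)/M^*_x\|_2\le\varepsilon$ for all $x\in\Delta(n)$. For $d\ge 0$ and $\lambda>0$ let $\mathcal M_{BMLP}$ be the class of models with $M(v)_i=f_i(v)$ on $\Delta(n)$, where each $f_i$ is a polynomial in $v_1,\dots,v_n$ of total degree at most $d$ and of degree at most $1$ in each variable, with values in $[\lambda,1]$ on $\Delta(n)$. Let $\mathcal M_{BNMP}$ be the class of models with $M(v)_i=f_i(v)$ on $\Delta(n)$, where each $f_i$ is a polynomial of total degree at most $d$ with values in $[\lambda,1]$ on $\Delta(n)$, and $\sum_i f_i$ is constant on $\Delta(n)$. **Lemma.** (a) There are absolute constants $C,p\in\mathbb N$ and $c>0$ such that for all $n,k\ge1$, $d\ge 0$ and $\lambda$ with $k^2/n\le\lambda\le 1$, the class $\mathcal M_{BMLP}$ is $Cn^d$-locally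 learnable around the uniform vector $(1/n,\dots,1/n)$ for $$\beta\le \frac{c\,\varepsilon^2}{\bigl(n\,(d/\alpha)^d\bigr)^p}.$$ (b) There are an absolute constant $C\in\mathbb N$ and a function $F:\mathbb N^2\to(0,\infty)$ such that for all $n,k\ge1$, $d\ge0$ and $\lambda$ with $k^2/n\le\lambda\le1$, the class $\mathcal M_{BNMP}$ is $Cn^d$-locally learnable around the uniform vector for $$\beta\le\frac{\varepsilon\,\alpha^d}{F(n,d)}.$$ (Here $0^0=1$.) -/

import Mathlib

noncomputable section

/-- A preference model on `n` items: it maps each memory vector in the simplex `Δ(n)` to a vector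
of scores in `[0,1]^n`. -/
abbrev PreferenceModel (n : ℕ) : Type :=
  stdSimplex ℝ (Fin n) → Fin n → unitInterval

/-- The normalized score vector `M(v) / M*_v`, where `M*_v = ∑ i, M(v)_i`. -/
def normScore {n : ℕ} (M : PreferenceModel n) (v : stdSimplex ℝ (Fin n)) : Fin n → ℝ :=
  fun i => (M v i : ℝ) / ∑ j, (M v j : ℝ)

/-- The item choice distribution `p_{K,v}` of an Agent with memory `v` who is shown the menu `K`. -/
def menuDist {n : ℕ} (M : PreferenceModel n) (v : stdSimplex ℝ (Fin n)) (K : Finset (Fin n)) :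
    Fin n → ℝ :=
  fun i => if i ∈ K then (M v i : ℝ) / ∑ j ∈ K, (M v j : ℝ) else 0

/-- Instantaneously realizable distributions at `v`, for menus of size `k`. -/
def IRD {n : ℕ} (k : ℕ) (M : PreferenceModel n) (v : stdSimplex ℝ (Fin n)) :
    Set (Fin n → ℝ) :=
  convexHull ℝ {p | ∃ K : Finset (Fin n), K.card = k ∧ p = menuDist M v K}

/-- Everywhere instantaneously realizable distributions of a single model. -/
def EIRD {n : ℕ} (k : ℕ) (M : PreferenceModel n) : Set (Fin n → ℝ) :=
  {x | x ∈ stdSimplex ℝ (Fin n) ∧ ∀ v : stdSimplex ℝ (Fin n), x ∈ IRD k M v}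

/-- Everywhere instantaneously realizable distributions of a class of models. -/
def classEIRD {n : ℕ} (k : ℕ) (𝓜 : Set (PreferenceModel n)) : Set (Fin n → ℝ) :=
  {x | x ∈ stdSimplex ℝ (Fin n) ∧ ∀ M ∈ 𝓜, x ∈ EIRD k M}

/-- The uniform vector `(1/n, …, 1/n)`. -/
def uniformVector (n : ℕ) : Fin n → ℝ := fun _ => 1 / (n : ℝ)

/-- The set `V_α` of points of the hyperplane `∑ i, v_i = 1` (the affine hull of the simplex) within
Euclidean distance `α` of `vstar`. -/
def localBall {n : ℕ} (vstar : Fin n → ℝ) (α : ℝ) : Set (Fin n → ℝ) :=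
  {v | ∑ i, v i = 1 ∧ ‖WithLp.toLp 2 (v - vstar)‖ ≤ α}

/-- A (possibly adaptive) learning algorithm that makes `h` queries: the `j`-th query point is
computed from the answers to the preceding queries, and the hypothesis model from all answers. -/
structure QueryAlgorithm (n h : ℕ) where
  query : (j : Fin h) → (Fin j → Fin n → ℝ) → stdSimplex ℝ (Fin n)
  hypothesis : (Fin h → Fin n → ℝ) → PreferenceModel n

/-- The `j`-th point queried by `A` when the successive answers are `ans`. -/
def QueryAlgorithm.queryPoint {n h : ℕ} (A : QueryAlgorithm n h) (ans : Fin h → Fin n → ℝ)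
    (j : Fin h) : stdSimplex ℝ (Fin n) :=
  A.query j (fun i => ans ⟨i, i.2.trans j.2⟩)

/-- `A` only queries points of `V`, and for every model `M` of the class, whenever each answer is
within `β` in the sup norm of the true normalized score vector at the queried point, its hypothesis
has positive total score and normalized score vector within Euclidean distance `ε` of that of `M`,
at every point of the simplex. -/
def QueryAlgorithm.Learns {n h : ℕ} (A : QueryAlgorithm n h) (𝓜 : Set (PreferenceModel n))
    (V : Set (Fin n → ℝ)) (β ε : ℝ) : Prop :=
  (∀ (ans : Fin h → Fin n → ℝ) (j : Fin h), (A.queryPoint ans j : Fin n → ℝ) ∈ V) ∧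
  ∀ M ∈ 𝓜, ∀ ans : Fin h → Fin n → ℝ,
    (∀ j, ‖ans j - normScore M (A.queryPoint ans j)‖ ≤ β) →
    ∀ x : stdSimplex ℝ (Fin n),
      0 < ∑ i, (A.hypothesis ans x i : ℝ) ∧
      ‖WithLp.toLp 2 (normScore (A.hypothesis ans) x - normScore M x)‖ ≤ ε

/-- The class `𝓜` is `h`-locally learnable around `vstar`, with admissible query error
`β ≤ B ε α` for target accuracy `ε` and query radius `α` (menus have size `k`). Some ball of positive
radius around `vstar` is required to lie in the `EIRD` set of the class, so that the quantifier
over `α` is not vacuous. -/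
def IsLocallyLearnableAround {n : ℕ} (k h : ℕ) (𝓜 : Set (PreferenceModel n))
    (vstar : Fin n → ℝ) (B : ℝ → ℝ → ℝ) : Prop :=
  vstar ∈ classEIRD k 𝓜 ∧
  (∃ α > 0, localBall vstar α ⊆ classEIRD k 𝓜) ∧
  ∀ α > 0, localBall vstar α ⊆ classEIRD k 𝓜 →
    ∀ ε > 0, ∀ β ≥ 0, β ≤ B ε α →
      ∃ A : QueryAlgorithm n h, A.Learns 𝓜 (localBall vstar α) β ε

/-- Bounded-degree multilinear polynomial preference models, with scores in `[lam, 1]`. -/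
def classBMLP (n d : ℕ) (lam : ℝ) : Set (PreferenceModel n) :=
  {M | ∃ f : Fin n → MvPolynomial (Fin n) ℝ,
    (∀ i, (f i).totalDegree ≤ d ∧ ∀ j, (f i).degreeOf j ≤ 1) ∧
    ∀ (v : stdSimplex ℝ (Fin n)) (i : Fin n),
      MvPolynomial.eval (v : Fin n → ℝ) (f i) ∈ Set.Icc lam 1 ∧
      (M v i : ℝ) = MvPolynomial.eval (v : Fin n → ℝ) (f i)}

/-- Bounded-degree normalized multivariate polynomial preference models, with scores in
`[lam, 1]` that sum to a constant. -/
def classBNMP (n d : ℕ) (lam : ℝ) : Set (PreferenceModel n) :=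
  {M | ∃ f : Fin n → MvPolynomial (Fin n) ℝ,
    (∀ i, (f i).totalDegree ≤ d) ∧
    (∀ (v : stdSimplex ℝ (Fin n)) (i : Fin n),
      MvPolynomial.eval (v : Fin n → ℝ) (f i) ∈ Set.Icc lam 1 ∧
      (M v i : ℝ) = MvPolynomial.eval (v : Fin n → ℝ) (f i)) ∧
    ∃ c : ℝ, ∀ v : stdSimplex ℝ (Fin n),
      ∑ i, MvPolynomial.eval (v : Fin n → ℝ) (f i) = c}

end

open Finset

/-! Realizability: `x` lies in `IRD` at `v` as soon as no `k * x i / M v i` exceeds `∑ j, x j / M v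
j`, by Birkhoff's theorem. Scores in `[k²/n, 1]` give this condition for all `x` within `1/n` of the
uniform vector.

Learning: the algorithm outputs any model consistent with the answers, so it is enough that two
consistent models have close normalized scores on the simplex. On the hyperplane `∑ v_i = 1`,
polynomials of degree at most `d` are spanned by `N = n^d` monomials. A barycentric spanner yields
`N` nodes in the ball from which all these polynomials are interpolated on the ball with
coefficients in `[-1, 1]`. Closeness on the ball spreads to the simplex by Lagrange extrapolation
along segments from the centre.

In (b) the normalized scores are themselves polynomials of degree at most `d`, so querying the `N`
nodes suffices. In (a) they are quotients `f_i / F` with `F = ∑ f_j`, and values at the nodes do not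
determine them. After querying the nodes, query wherever two consistent models still differ by more
than `γ`; each answer refutes one of them. Interpolation makes `F(v) * (answer - score)` nearly a
linear functional of the vector of values of `F` at the nodes, known from the answers. Each refuted
model thus gives a vector that the earlier functionals hardly detect and the current one does. The
potential bound `elliptical_potential` forbids `2 * N` such rounds, so `3 * N` queries are enough.
-/

/-! ### Realizable distributions near the uniform vector -/

theorem exists_convex_comb_indicator_of_sum_eq {n k : ℕ} (hk : 1 ≤ k) (hkn : k ≤ n) {π : Fin n → ℝ}
    (h0 : ∀ i, 0 ≤ π i) (h1 : ∀ i, π i ≤ 1) (hs : ∑ i, π i = k) :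
    ∃ (w : Equiv.Perm (Fin n) → ℝ) (K : Equiv.Perm (Fin n) → Finset (Fin n)),
      (∀ σ, 0 ≤ w σ) ∧ (∀ σ, (K σ).card = k) ∧
      ∀ i, ∑ σ, w σ * (if i ∈ K σ then 1 else 0) = π i := by
  have hk0 : (0 : ℝ) < k := by exact_mod_cast hk
  have hcard : (univ.filter fun a : Fin n => (a : ℕ) < k).card = k := by
    simp [Fin.card_filter_val_lt, hkn]
  have hcard' : (univ.filter fun a : Fin n => ¬ (a : ℕ) < k).card = n - k := by
    have := card_filter_add_card_filter_not (s := (univ : Finset (Fin n))) (fun a => (a : ℕ) < k)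
    rw [hcard, card_univ, Fintype.card_fin] at this
    omega
  -- The first `k` rows share out `π`, the others share out `1 - π`. In a permutation matrix the
  -- first `k` rows hit exactly `k` columns, so Birkhoff's decomposition of `A` gives the sets `K
  -- σ`.
  let A : Matrix (Fin n) (Fin n) ℝ := fun a i =>
    if (a : ℕ) < k then π i / k else (1 - π i) / (n - k)
  have hkn' : (0 : ℝ) ≤ n - k := by
    have : (k : ℝ) ≤ n := by exact_mod_cast hkn
    linarith
  have hA : A ∈ doublyStochastic ℝ (Fin n) := by
    rw [mem_doublyStochastic_iff_sum]
    refine ⟨fun a i => ?_, fun a => ?_, fun i => ?_⟩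
    · simp only [A]
      split_ifs
      · exact div_nonneg (h0 i) hk0.le
      · exact div_nonneg (by linarith [h1 i]) hkn'
    · by_cases ha : (a : ℕ) < k
      · simp only [A, ha, if_true, ← sum_div, hs]
        exact div_self hk0.ne'
      · have hlt : (k : ℝ) < n := by exact_mod_cast (by omega : k < n)
        simp only [A, ha, if_false, ← sum_div, sum_sub_distrib, hs]
        simp only [sum_const, card_univ, Fintype.card_fin, nsmul_eq_mul, mul_one]
        exact div_self (by linarith)
    · simp only [A, sum_ite, sum_const, hcard, hcard', nsmul_eq_mul, Nat.cast_sub hkn]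
      rcases hkn.eq_or_lt with rfl | hlt
      · have hall : ∀ i, π i = 1 := by
          have : ∑ i, (1 - π i) = 0 := by simp [sum_sub_distrib, hs]
          rw [sum_eq_zero_iff_of_nonneg (fun i _ => by linarith [h1 i])] at this
          intro i
          linarith [this i (mem_univ i)]
        rw [hall i]
        field_simp
        simp
      · have : (0 : ℝ) < n - k := by
          have : (k : ℝ) < n := by exact_mod_cast hlt
          linarith
        field_simp
        ring
  obtain ⟨w, hw0, -, hwA⟩ := exists_eq_sum_perm_of_mem_doublyStochastic hA
  refine ⟨w, fun σ => (univ.filter fun a : Fin n => (a : ℕ) < k).map σ.toEmbedding, hw0,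
    fun σ => by rw [card_map, hcard], fun i => ?_⟩
  have hcol : ∑ a ∈ univ.filter (fun a : Fin n => (a : ℕ) < k), A a i = π i := by
    rw [sum_congr rfl (g := fun _ => π i / k)
      (fun a ha => by simp only [A, (mem_filter.1 ha).2, if_true])]
    rw [sum_const, hcard, nsmul_eq_mul]
    field_simp
  rw [← hcol, ← hwA]
  simp only [Matrix.sum_apply, Matrix.smul_apply, smul_eq_mul]
  rw [sum_comm]
  refine sum_congr rfl fun σ _ => ?_
  rw [← mul_sum]
  congr 1
  simp only [Equiv.Perm.permMatrix, PEquiv.toMatrix_apply, Equiv.toPEquiv_apply,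
    Option.mem_def, Option.some.injEq]
  by_cases hi : ((σ.symm i : Fin n) : ℕ) < k
  · rw [if_pos (mem_map.2 ⟨σ.symm i, by simpa using hi, by simp⟩),
      sum_eq_single_of_mem (σ.symm i) (by simpa using hi)]
    · simp
    · intro b _ hb
      rw [if_neg]
      rintro rfl
      exact hb (by simp)
  · rw [if_neg, sum_eq_zero]
    · intro b hb
      rw [if_neg]
      rintro rfl
      exact hi (by simpa using hb)
    · intro h
      obtain ⟨b, hb, rfl⟩ := mem_map.1 h
      exact hi (by simpa using hb)

/-- After scaling to sum `k`, the numbers `x i / M v i` lie in `[0, 1]`, hence form a combination of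
indicators of `k`-sets. Weighting each menu also by its total score cancels the denominator of
`menuDist` and leaves `x`. -/
theorem mem_IRD_of_mul_le {n k : ℕ} (hk : 1 ≤ k) (hkn : k ≤ n) {M : PreferenceModel n}
    {v : stdSimplex ℝ (Fin n)} (hM : ∀ i, 0 < (M v i : ℝ)) {x : Fin n → ℝ}
    (hx : x ∈ stdSimplex ℝ (Fin n))
    (hle : ∀ i, k * (x i / M v i) ≤ ∑ j, x j / M v j) : x ∈ IRD k M v := by
  have hk0 : (0 : ℝ) < k := by exact_mod_cast hk
  set S := ∑ j, x j / (M v j : ℝ) with hS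
  have hq0 : ∀ i, 0 ≤ x i / (M v i : ℝ) := fun i => div_nonneg (hx.1 i) (hM i).le
  have hSpos : 0 < S := by
    obtain ⟨i, -, hi⟩ : ∃ i ∈ univ, (0 : ℝ) < x i := by
      apply exists_lt_of_sum_lt
      simpa using (by rw [hx.2]; exact one_pos : (0 : ℝ) < ∑ i, x i)
    exact sum_pos' (fun i _ => hq0 i) ⟨i, mem_univ i, div_pos hi (hM i)⟩
  obtain ⟨w, K, hw0, hK, hw⟩ := exists_convex_comb_indicator_of_sum_eq hk hkn
    (π := fun i => k * (x i / M v i) / S)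
    (fun i => div_nonneg (mul_nonneg hk0.le (hq0 i)) hSpos.le)
    (fun i => (div_le_one hSpos).2 (hle i))
    (by rw [← sum_div, ← mul_sum, ← hS]; field_simp)
  have hW : ∀ σ, 0 < ∑ j ∈ K σ, (M v j : ℝ) := fun σ =>
    sum_pos (fun i _ => hM i) (card_pos.1 (by rw [hK]; exact hk))
  have hsum : ∀ i, ∑ σ, (S / k * (w σ * ∑ j ∈ K σ, (M v j : ℝ))) * menuDist M v (K σ) i = x i := by
    intro i
    have : ∀ σ, (S / k * (w σ * ∑ j ∈ K σ, (M v j : ℝ))) * menuDist M v (K σ) i =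
        S / k * M v i * (w σ * (if i ∈ K σ then 1 else 0)) := by
      intro σ
      have := (hW σ).ne'
      unfold menuDist
      split_ifs
      · field_simp
      · simp
    rw [sum_congr rfl fun σ _ => this σ, ← mul_sum, hw i]
    have := (hM i).ne'
    field_simp
  rw [IRD, mem_convexHull_iff_exists_fintype]
  refine ⟨_, inferInstance, fun σ => S / k * (w σ * ∑ j ∈ K σ, (M v j : ℝ)),
    fun σ => menuDist M v (K σ), fun σ => ?_, ?_, fun σ => ⟨K σ, hK σ, rfl⟩, ?_⟩
  · exact mul_nonneg (div_nonneg hSpos.le hk0.le) (mul_nonneg (hw0 σ) (hW σ).le)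
  · rw [← hx.2, ← sum_congr rfl fun i _ => hsum i, sum_comm]
    refine sum_congr rfl fun σ _ => ?_
    rw [← mul_sum]
    have : ∑ i, menuDist M v (K σ) i = 1 := by
      simp only [menuDist, sum_ite_mem, univ_inter, ← sum_div]
      exact div_self (hW σ).ne'
    rw [this, mul_one]
  · ext i
    rw [← hsum i]
    simp

theorem abs_sub_uniformVector_le {n : ℕ} {α : ℝ} {x : Fin n → ℝ}
    (hx : x ∈ localBall (uniformVector n) α) (i : Fin n) : |x i - 1 / n| ≤ α :=
  (PiLp.norm_apply_le (WithLp.toLp 2 (x - uniformVector n)) i).trans hx.2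

theorem one_div_le_of_sq_div_le {n k : ℕ} {lam : ℝ} (hk : 1 ≤ k) (h : (k : ℝ) ^ 2 / n ≤ lam) :
    1 / (n : ℝ) ≤ lam := by
  refine le_trans ?_ h
  have : (1 : ℝ) ≤ k := by exact_mod_cast hk
  gcongr
  nlinarith

theorem localBall_subset_EIRD {n k : ℕ} {lam : ℝ} (hn : 1 ≤ n) (hk : 1 ≤ k)
    (hlam : (k : ℝ) ^ 2 / n ≤ lam) (hlam1 : lam ≤ 1) {M : PreferenceModel n}
    (hM : ∀ v i, lam ≤ (M v i : ℝ)) :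
    localBall (uniformVector n) (1 / n) ⊆ {x | x ∈ stdSimplex ℝ (Fin n) ∧ x ∈ EIRD k M} := by
  have hn0 : (0 : ℝ) < n := by exact_mod_cast hn
  have hk1 : (1 : ℝ) ≤ k := by exact_mod_cast hk
  have hk2 : (k : ℝ) ^ 2 ≤ lam * n := (div_le_iff₀ hn0).1 hlam
  have hkn : k ≤ n := by
    have : (k : ℝ) ≤ n := by nlinarith
    exact_mod_cast this
  have hpos : 0 < lam := lt_of_lt_of_le (by positivity) (one_div_le_of_sq_div_le hk hlam)
  intro x hx
  have hxs : x ∈ stdSimplex ℝ (Fin n) := ⟨fun i => by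
    linarith [(abs_le.1 (abs_sub_uniformVector_le hx i)).1], hx.1⟩
  refine ⟨hxs, hxs, fun v => mem_IRD_of_mul_le hk hkn (fun i => hpos.trans_le (hM v i)) hxs ?_⟩
  intro i
  have hnn : ∀ j, 0 ≤ x j / (M v j : ℝ) := fun j =>
    div_nonneg (hxs.1 j) (hpos.le.trans (hM v j))
  -- For `k = 1` a single term is compared with the whole sum. For `k ≥ 2`, `x i ≤ 2 / n ≤ k / n`
  -- gives `k * x i ≤ k ^ 2 / n ≤ lam`, so the left side is at most `1 = ∑ x j`.
  rcases hk.eq_or_lt with rfl | hk'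
  · rw [Nat.cast_one, one_mul]
    exact single_le_sum (f := fun j => x j / (M v j : ℝ)) (fun j _ => hnn j) (mem_univ i)
  · have hk' : (2 : ℝ) ≤ k := by exact_mod_cast hk'
    have hxi : x i ≤ 2 / n := by
      have := (abs_le.1 (abs_sub_uniformVector_le hx i)).2
      have h2 : (2 : ℝ) / n = 1 / n + 1 / n := by ring
      linarith
    have h1 : (k : ℝ) * (x i / M v i) ≤ 1 := by
      rw [← mul_div_assoc, div_le_one (hpos.trans_le (hM v i))]
      calc (k : ℝ) * x i ≤ k * (2 / n) := by gcongr
        _ ≤ k * (k / n) := by gcongr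
        _ = (k : ℝ) ^ 2 / n := by ring
        _ ≤ _ := hlam.trans (hM v i)
    refine h1.trans ?_
    rw [← hx.1]
    refine sum_le_sum fun j _ => ?_
    rw [le_div_iff₀ (hpos.trans_le (hM v j))]
    exact mul_le_of_le_one_right (hxs.1 j) (M v j).2.2

/-! ### Interpolation of polynomials from `n ^ d` nodes -/

theorem exists_eq_sum_prod_of_mul {n d : ℕ} (w : Fin n → ℝ) (c : (Fin d → Fin n) → ℝ) :
    ∃ c' : (Fin (d + 1) → Fin n) → ℝ, ∀ v : Fin n → ℝ,
      (∑ i, w i * v i) * ∑ φ, c φ * ∏ j, v (φ j) = ∑ φ, c' φ * ∏ j, v (φ j) := by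
  refine ⟨fun φ => w (φ 0) * c (Fin.tail φ), fun v => ?_⟩
  rw [← (Fin.consEquiv fun _ => Fin n).sum_comp, Fintype.sum_prod_type, sum_mul_sum]
  refine sum_congr rfl fun i _ => sum_congr rfl fun φ _ => ?_
  simp [Fin.consEquiv, Fin.prod_univ_succ]
  ring

/-- Monomials of degree below `d` are homogenized by multiplying with `∑ v i = 1`. Indexing by words
`Fin d → Fin n` makes the number of spanning functions exactly `n ^ d`. -/
theorem exists_prod_pow_eq_sum_prod {n : ℕ} (d : ℕ) (m : Fin n →₀ ℕ) (hm : m.degree ≤ d) :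
    ∃ c : (Fin d → Fin n) → ℝ, ∀ v : Fin n → ℝ, ∑ i, v i = 1 →
      ∏ i, v i ^ m i = ∑ φ, c φ * ∏ j, v (φ j) := by
  induction d generalizing m with
  | zero =>
    have : m = 0 := (Finsupp.degree_eq_zero_iff m).1 (Nat.le_zero.1 hm)
    exact ⟨fun _ => 1, fun v _ => by simp [this]⟩
  | succ d ih =>
    by_cases h0 : m = 0
    · subst h0
      obtain ⟨c, hc⟩ := ih 0 (by simp)
      obtain ⟨c', hc'⟩ := exists_eq_sum_prod_of_mul (fun _ => 1) c
      refine ⟨c', fun v hv => ?_⟩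
      rw [← hc', ← hc v hv]
      simp [hv]
    · obtain ⟨i, hi⟩ := Finsupp.ne_iff.1 h0
      have hi' : Finsupp.single i 1 ≤ m := by
        rw [Finsupp.single_le_iff]
        exact Nat.one_le_iff_ne_zero.2 hi
      obtain ⟨m', rfl⟩ := exists_add_of_le hi'
      obtain ⟨c, hc⟩ := ih m' (by
        rw [map_add, Finsupp.degree_single] at hm
        omega)
      obtain ⟨c', hc'⟩ := exists_eq_sum_prod_of_mul (Pi.single i 1) c
      refine ⟨c', fun v hv => ?_⟩
      rw [← hc', ← hc v hv]
      simp only [Finsupp.add_apply, pow_add, prod_mul_distrib]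
      congr 1
      rw [prod_eq_single i]
      · simp [Pi.single_apply]
      · intro b _ hb
        simp [hb.symm]
      · simp

theorem exists_eval_eq_sum_prod {n d : ℕ} (f : MvPolynomial (Fin n) ℝ) (hf : f.totalDegree ≤ d) :
    ∃ c : (Fin d → Fin n) → ℝ, ∀ v : Fin n → ℝ, ∑ i, v i = 1 →
      MvPolynomial.eval v f = ∑ φ, c φ * ∏ j, v (φ j) := by
  have h : ∀ m : f.support, ∃ c : (Fin d → Fin n) → ℝ, ∀ v : Fin n → ℝ, ∑ i, v i = 1 →
      ∏ i, v i ^ (m : Fin n →₀ ℕ) i = ∑ φ, c φ * ∏ j, v (φ j) := by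
    intro m
    have hm : (m : Fin n →₀ ℕ).degree ≤ f.totalDegree := by
      rw [Finsupp.degree_apply]
      exact MvPolynomial.le_totalDegree m.2
    exact exists_prod_pow_eq_sum_prod d (m : Fin n →₀ ℕ) (hm.trans hf)
  choose c hc using h
  refine ⟨fun φ => ∑ m : f.support, f.coeff m * c m φ, fun v hv => ?_⟩
  rw [MvPolynomial.eval_eq', ← sum_coe_sort]
  simp only [hc _ v hv, sum_mul, mul_sum]
  rw [sum_comm]
  exact sum_congr rfl fun _ _ => sum_congr rfl fun _ _ => by ring

/-- Take vectors of `S` maximizing `|det|` within the span of `S`. By Cramer's rule each coordinate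
of `y ∈ S` is a ratio of two such determinants, the maximal one below. If the span is proper, the
family is padded with a point of `S` that gets coefficient `0`. -/
theorem exists_barycentric_spanner {ι : Type*} [Fintype ι] {S : Set (ι → ℝ)} (hS : IsCompact S)
    (hne : S.Nonempty) :
    ∃ s : ι → ι → ℝ, (∀ j, s j ∈ S) ∧
      ∀ y ∈ S, ∃ c : ι → ℝ, (∀ j, |c j| ≤ 1) ∧ y = ∑ j, c j • s j := by
  classical
  obtain ⟨y₀, hy₀⟩ := hne
  let U := Submodule.span ℝ S
  let S' : Set U := Subtype.val ⁻¹' S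
  have hSU : ∀ y ∈ S, y ∈ U := fun y hy => Submodule.subset_span hy
  have hspan : ⊤ ≤ Submodule.span ℝ S' := by
    rw [top_le_iff]
    exact Submodule.span_span_coe_preimage
  have hS' : IsCompact S' :=
    (Submodule.closed_of_finiteDimensional U).isClosedEmbedding_subtypeVal.isCompact_preimage hS
  obtain ⟨κ, _, B, hBmem⟩ : ∃ (κ : Set U) (_ : Fintype κ) (B : Module.Basis κ ℝ U),
      ∀ i, B i ∈ S' := by
    refine ⟨_, ?_, Module.Basis.ofSpan hspan, fun i => Module.Basis.ofSpan_subset hspan ⟨i, rfl⟩⟩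
    exact @Fintype.ofFinite _ (Module.Finite.finite_basis (Module.Basis.ofSpan hspan))
  have hcard := Module.finrank_eq_card_basis B
  have hcont : Continuous fun t : κ → U => |B.det t| := by
    have h : Continuous fun t : κ → U => B.det t := ?_
    · exact h.abs
    simp only [Module.Basis.det_apply]
    refine Continuous.matrix_det (continuous_matrix fun i j => ?_)
    simp only [Module.Basis.toMatrix_apply]
    exact (LinearMap.continuous_of_finiteDimensional (B.coord i)).comp (continuous_apply j)
  obtain ⟨t, ht, hmax⟩ := (isCompact_univ_pi fun _ : κ => hS').exists_isMaxOn
    ⟨B, fun i _ => hBmem i⟩ hcont.continuousOn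
  have hdet : 1 ≤ |B.det t| := by
    have := hmax (show (B : κ → U) ∈ Set.univ.pi fun _ => S' from fun i _ => hBmem i)
    simpa [Module.Basis.det_self] using this
  have hdet0 : 0 < |B.det t| := one_pos.trans_le hdet
  obtain ⟨hli, hsp⟩ := (Module.Basis.is_basis_iff_det B).2
    (isUnit_iff_ne_zero.2 (abs_pos.1 hdet0))
  have hle : Fintype.card κ ≤ Fintype.card ι := by
    rw [← hcard]
    exact (Submodule.finrank_le U).trans (Module.finrank_fintype_fun_eq_card ℝ).le
  obtain ⟨e⟩ := Function.Embedding.nonempty_of_card_le hle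
  refine ⟨Function.extend e (fun j => (t j : ι → ℝ)) fun _ => y₀, fun j => ?_, fun y hy => ?_⟩
  · by_cases hj : ∃ a, e a = j
    · obtain ⟨a, rfl⟩ := hj
      rw [e.injective.extend_apply]
      exact ht a trivial
    · rw [Function.extend_apply' _ _ _ hj]
      exact hy₀
  · let y' : U := ⟨y, hSU y hy⟩
    let C := Module.Basis.mk hli hsp.ge
    refine ⟨Function.extend e (fun j => C.coord j y') 0, fun j => ?_, ?_⟩
    · by_cases hj : ∃ a, e a = j
      · obtain ⟨a, rfl⟩ := hj
        rw [e.injective.extend_apply]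
        have h1 := congrArg (fun l => l y') (B.det_smul_mk_coord_eq_det_update hli hsp.ge a)
        simp only [LinearMap.smul_apply, smul_eq_mul] at h1
        have h2 : |B.det (Function.update t a y')| ≤ |B.det t| := by
          refine hmax (show Function.update t a y' ∈ Set.univ.pi fun _ => S' from fun i _ => ?_)
          by_cases hi : i = a
          · subst hi
            rw [Function.update_self]
            exact hy
          · rw [Function.update_of_ne hi]
            exact ht i trivial
        have h3 : |B.det t| * |C.coord a y'| ≤ |B.det t| := by
          rw [← abs_mul, h1]
          exact h2
        exact le_of_mul_le_mul_left (by simpa using h3) hdet0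
      · rw [Function.extend_apply' _ _ _ hj]
        simp
    · have h1 : ∑ a, C.coord a y' • t a = y' := by
        have := C.sum_repr y'
        simpa [C] using this
      have h2 : y = ∑ a, C.coord a y' • (t a : ι → ℝ) := by
        simpa [y'] using (congrArg Subtype.val h1).symm
      rw [h2]
      refine Fintype.sum_of_injective e e.injective _ _ (fun j hj => ?_) fun a => ?_
      · rw [Function.extend_apply' _ _ _ (by simpa using hj)]
        simp
      · rw [e.injective.extend_apply, e.injective.extend_apply]

/-- Apply the spanner to the image of `X` under `v ↦ (b i v)`; its elements come from points of `X`,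
which are the nodes. -/
theorem exists_interpolation_nodes {E ι : Type*} [TopologicalSpace E] [Fintype ι] {X : Set E}
    (hX : IsCompact X) (hne : X.Nonempty) {b : ι → E → ℝ} (hb : ∀ i, ContinuousOn (b i) X) :
    ∃ (q : ι → E) (l : ι → E → ℝ), (∀ j, q j ∈ X) ∧ (∀ j, ∀ v ∈ X, |l j v| ≤ 1) ∧
      ∀ c : ι → ℝ, ∀ v ∈ X, ∑ i, c i * b i v = ∑ j, l j v * ∑ i, c i * b i (q j) := by
  classical
  obtain ⟨s, hs, hspan⟩ := exists_barycentric_spanner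
    (hX.image_of_continuousOn (continuousOn_pi.2 hb)) (hne.image _)
  choose q hq hqs using hs
  have : ∀ v, ∃ c : ι → ℝ, v ∈ X → (∀ j, |c j| ≤ 1) ∧ (fun i => b i v) = ∑ j, c j • s j := by
    intro v
    by_cases hv : v ∈ X
    · obtain ⟨c, hc⟩ := hspan _ ⟨v, hv, rfl⟩
      exact ⟨c, fun _ => hc⟩
    · exact ⟨0, fun h => absurd h hv⟩
  choose l hl using this
  refine ⟨q, fun j v => l v j, hq, fun j v hv => (hl v hv).1 j, fun c v hv => ?_⟩
  have h : ∀ i, b i v = ∑ j, l v j * b i (q j) := fun i => by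
    have := congrFun (hl v hv).2 i
    simpa [← hqs] using this
  simp only [h, mul_sum]
  rw [sum_comm]
  exact sum_congr rfl fun _ _ => sum_congr rfl fun _ _ => by ring

theorem exists_polynomial_interpolation_nodes {n d : ℕ} {X : Set (Fin n → ℝ)} (hX : IsCompact X)
    (hne : X.Nonempty) (hX1 : ∀ v ∈ X, ∑ i, v i = 1) :
    ∃ (q : Fin (n ^ d) → Fin n → ℝ) (l : Fin (n ^ d) → (Fin n → ℝ) → ℝ),
      (∀ j, q j ∈ X) ∧ (∀ j, ∀ v ∈ X, |l j v| ≤ 1) ∧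
      ∀ f : MvPolynomial (Fin n) ℝ, f.totalDegree ≤ d → ∀ v ∈ X,
        MvPolynomial.eval v f = ∑ j, l j v * MvPolynomial.eval (q j) f := by
  obtain ⟨q, l, hq, hl, hql⟩ := exists_interpolation_nodes (ι := Fin d → Fin n) hX hne
    (b := fun φ v => ∏ j, v (φ j)) fun φ => by fun_prop
  have e : (Fin d → Fin n) ≃ Fin (n ^ d) := Fintype.equivFinOfCardEq (by simp)
  refine ⟨q ∘ e.symm, fun j => l (e.symm j), fun j => hq _, fun j => hl _, fun f hf v hv => ?_⟩
  obtain ⟨c, hc⟩ := exists_eval_eq_sum_prod f hf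
  rw [hc v (hX1 v hv), hql c v hv, ← e.symm.sum_comp]
  exact sum_congr rfl fun j _ => by rw [Function.comp_apply, hc _ (hX1 _ (hq _))]

/-! ### Extrapolation from the ball to the simplex -/

theorem abs_eval_one_le_of_abs_eval_le {g : Polynomial ℝ} {D : ℕ} (hg : g.natDegree ≤ D) {α B : ℝ}
    (hα : 0 < α) (hα1 : α ≤ 1) (hB : ∀ t ∈ Set.Icc 0 α, |g.eval t| ≤ B) :
    |g.eval 1| ≤ (D + 1) * (D / α) ^ D * B := by
  -- Lagrange interpolation at `D + 1` equally spaced nodes: each of the `D` factors of a basis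
  -- polynomial at `1` is at most `D / α`.
  let x : ℕ → ℝ := fun j => α * (j / D)
  rcases Nat.eq_zero_or_pos D with rfl | hD
  · rw [Polynomial.eq_C_of_natDegree_le_zero hg] at hB ⊢
    simpa using hB 0 ⟨le_rfl, hα.le⟩
  have hD0 : (0 : ℝ) < D := by exact_mod_cast hD
  have hxI : ∀ j ∈ range (D + 1), x j ∈ Set.Icc 0 α := by
    intro j hj
    have : (j : ℝ) ≤ D := by exact_mod_cast Nat.lt_succ_iff.1 (mem_range.1 hj)
    exact ⟨by positivity, mul_le_of_le_one_right hα.le ((div_le_one hD0).2 this)⟩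
  have hdist : ∀ i j : ℕ, i ≠ j → α / D ≤ |x i - x j| := by
    intro i j hij
    have h1 : x i - x j = α / D * (((i : ℤ) - j : ℤ) : ℝ) := by
      simp only [x]
      push_cast
      ring
    rw [h1, abs_mul, abs_of_pos (by positivity : 0 < α / D)]
    refine le_mul_of_one_le_right (by positivity) ?_
    have : (1 : ℤ) ≤ |(i : ℤ) - j| := Int.one_le_abs (by omega)
    exact_mod_cast this
  have hinj : Set.InjOn x (range (D + 1)) := by
    intro i _ j _ h
    by_contra hij
    have := hdist i j hij
    rw [h, sub_self, abs_zero] at this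
    exact absurd this (not_le.2 (by positivity))
  have hdeg : g.degree < (range (D + 1)).card := by
    rw [card_range]
    exact (Polynomial.degree_le_of_natDegree_le hg).trans_lt (by exact_mod_cast Nat.lt_succ_self D)
  rw [Lagrange.eq_interpolate hinj hdeg, Lagrange.interpolate_apply, Polynomial.eval_finsetSum]
  refine (abs_sum_le_sum_abs _ _).trans ?_
  have hterm : ∀ j ∈ range (D + 1), |Polynomial.eval 1 (Polynomial.C (Polynomial.eval (x j) g) *
      Lagrange.basis (range (D + 1)) x j)| ≤ (D / α) ^ D * B := by
    intro j hj
    rw [Polynomial.eval_mul, Polynomial.eval_C, abs_mul, mul_comm]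
    refine mul_le_mul ?_ (hB _ (hxI j hj)) (abs_nonneg _) (by positivity)
    rw [Lagrange.basis, Polynomial.eval_prod, abs_prod]
    have hcard : ((range (D + 1)).erase j).card = D := by
      rw [card_erase_of_mem hj, card_range, Nat.add_sub_cancel]
    refine (prod_le_prod (g := fun _ => D / α) (fun _ _ => abs_nonneg _) fun i hi => ?_).trans_eq
      (by rw [prod_const, hcard])
    obtain ⟨hij, hi⟩ := mem_erase.1 hi
    rw [Lagrange.basisDivisor]
    simp only [Polynomial.eval_mul, Polynomial.eval_C, Polynomial.eval_sub, Polynomial.eval_X,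
      abs_mul, abs_inv]
    have h1 : |1 - x i| ≤ 1 := by
      have := hxI i hi
      rw [abs_le]
      constructor <;> linarith [this.1, this.2]
    have h2 : |x j - x i|⁻¹ ≤ D / α := by
      rw [← inv_div]
      exact inv_anti₀ (by positivity) (hdist j i hij.symm)
    calc |x j - x i|⁻¹ * |1 - x i| ≤ (D / α) * 1 :=
          mul_le_mul h2 h1 (abs_nonneg _) (by positivity)
      _ = D / α := mul_one _
  refine (sum_le_card_nsmul _ _ _ hterm).trans_eq ?_
  rw [card_range, nsmul_eq_mul]
  push_cast
  ring

theorem norm_toLp_sub_uniformVector_le {n : ℕ} (hn : 1 ≤ n) {x : Fin n → ℝ}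
    (hx : x ∈ stdSimplex ℝ (Fin n)) : ‖WithLp.toLp 2 (x - uniformVector n)‖ ≤ 1 := by
  have hn0 : (0 : ℝ) < n := by exact_mod_cast hn
  have hle : ∀ i, x i ≤ 1 := fun i => by
    rw [← hx.2]
    exact single_le_sum (fun j _ => hx.1 j) (mem_univ i)
  rw [EuclideanSpace.norm_eq, Real.sqrt_le_iff]
  refine ⟨one_pos.le, ?_⟩
  calc ∑ i, ‖x i - 1 / n‖ ^ 2 = ∑ i, (x i ^ 2 - 2 / n * x i + (1 / n) ^ 2) := by
        refine sum_congr rfl fun i _ => ?_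
        rw [Real.norm_eq_abs, sq_abs]
        ring
    _ ≤ ∑ i, (x i - 2 / n * x i + (1 / n) ^ 2) := by
        refine sum_le_sum fun i _ => ?_
        nlinarith [hx.1 i, hle i]
    _ = 1 - 1 / n := by
        rw [sum_add_distrib, sum_sub_distrib, ← mul_sum, hx.2]
        simp
        field_simp
        ring
    _ ≤ 1 ^ 2 := by
        have : (0 : ℝ) < 1 / n := by positivity
        linarith

/-- Restrict `G` to the segment from the uniform vector (`t = 0`) to `x` (`t = 1`). Its length is at
most `1`, so the part `t ≤ α` stays in the ball. -/
theorem abs_eval_le_of_abs_eval_localBall_le {n D : ℕ} (hn : 1 ≤ n) {G : MvPolynomial (Fin n) ℝ}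
    (hG : G.totalDegree ≤ D) {α B : ℝ} (hα : 0 < α) (hα1 : α ≤ 1)
    (hB : ∀ v ∈ localBall (uniformVector n) α, |MvPolynomial.eval v G| ≤ B)
    {x : Fin n → ℝ} (hx : x ∈ stdSimplex ℝ (Fin n)) :
    |MvPolynomial.eval x G| ≤ (D + 1) * (D / α) ^ D * B := by
  have hn0 : (n : ℝ) ≠ 0 := by positivity
  let L : Fin n → Polynomial ℝ := fun i =>
    Polynomial.C (1 / (n : ℝ)) + Polynomial.C (x i - 1 / n) * Polynomial.X
  let g : Polynomial ℝ := MvPolynomial.aeval L G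
  have hg : g.natDegree ≤ D := by
    have := MvPolynomial.aeval_natDegree_le G hG L (n := 1) fun i => by
      simp only [L]
      compute_degree
    simpa using this
  have heval : ∀ t, g.eval t = MvPolynomial.eval (fun i => 1 / (n : ℝ) + (x i - 1 / n) * t) G := by
    intro t
    rw [← Polynomial.coe_aeval_eq_eval, MvPolynomial.comp_aeval_apply,
      MvPolynomial.aeval_eq_eval]
    simp [L]
  have h1 : MvPolynomial.eval x G = g.eval 1 := by
    rw [heval]
    simp
  rw [h1]
  refine abs_eval_one_le_of_abs_eval_le hg hα hα1 fun t ht => ?_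
  rw [heval]
  refine hB _ ⟨?_, ?_⟩
  · rw [sum_add_distrib, ← sum_mul, sum_sub_distrib, hx.2]
    simp [hn0]
  · have : (WithLp.toLp 2 ((fun i => 1 / (n : ℝ) + (x i - 1 / n) * t) - uniformVector n) :
        EuclideanSpace ℝ (Fin n)) = t • WithLp.toLp 2 (x - uniformVector n) := by
      ext i
      simp [uniformVector]
      ring
    rw [this, norm_smul, Real.norm_eq_abs, abs_of_nonneg ht.1]
    calc t * _ ≤ t * 1 := mul_le_mul_of_nonneg_left (norm_toLp_sub_uniformVector_le hn hx) ht.1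
      _ ≤ α := by rw [mul_one]; exact ht.2

/-! ### The elliptical potential -/

/-- Cauchy–Schwarz for the inner product of `V`, applied to `V⁻¹ a` and `z`. -/
theorem Matrix.PosDef.sq_dotProduct_le {ι : Type*} [Fintype ι] [DecidableEq ι]
    {V : Matrix ι ι ℝ} (hV : V.PosDef) (a z : ι → ℝ) :
    (a ⬝ᵥ z) ^ 2 ≤ (a ⬝ᵥ V⁻¹.mulVec a) * (z ⬝ᵥ V.mulVec z) := by
  have hu : IsUnit V.det := isUnit_iff_ne_zero.2 hV.det_pos.ne'
  set y := V⁻¹.mulVec a with hy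
  have hVy : V.mulVec y = a := by
    rw [hy, Matrix.mulVec_mulVec, Matrix.mul_nonsing_inv _ hu, Matrix.one_mulVec]
  have hsymm : ∀ w, y ⬝ᵥ V.mulVec w = a ⬝ᵥ w := by
    intro w
    have hT : V.transpose = V := by simpa using hV.isHermitian.eq
    rw [Matrix.dotProduct_mulVec, ← Matrix.mulVec_transpose, hT, hVy]
  have key : ∀ μ : ℝ, 0 ≤ (a ⬝ᵥ y) * (μ * μ) + (-2 * (a ⬝ᵥ z)) * μ + z ⬝ᵥ V.mulVec z := by
    intro μ
    have h := hV.posSemidef.dotProduct_mulVec_nonneg (z - μ • y)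
    simp only [star_trivial, Matrix.mulVec_sub, Matrix.mulVec_smul, hVy, sub_dotProduct,
      dotProduct_sub, smul_dotProduct, dotProduct_smul, hsymm, smul_eq_mul] at h
    rw [dotProduct_comm z a, dotProduct_comm y a] at h
    linarith
  have hdisc := discrim_le_zero key
  rw [discrim] at hdisc
  linarith

theorem Matrix.det_add_vecMulVec_self {ι : Type*} [Fintype ι] [DecidableEq ι]
    {V : Matrix ι ι ℝ} (hV : IsUnit V.det) (a : ι → ℝ) :
    (V + Matrix.vecMulVec a a).det = V.det * (1 + a ⬝ᵥ V⁻¹.mulVec a) := by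
  have h := Matrix.det_add_replicateCol_mul_replicateRow (ι := Unit) hV a a
  rw [← Matrix.vecMulVec_eq] at h
  rw [h]
  congr 1
  rw [Matrix.det_unique, Matrix.add_apply, Matrix.one_apply_eq, Matrix.dotProduct_mulVec]
  rfl

/-- The elliptical potential bound: a long sequence of vectors `a t`, each detecting a bounded
vector `z t` that its predecessors hardly detect, forces a large determinant. -/
theorem elliptical_potential {ι : Type*} [Fintype ι] {T : ℕ}
    {a z : ℕ → ι → ℝ} {η σ A R : ℝ} (hη : 0 < η) (hσ : 0 < σ)
    (ha : ∀ t < T, ∀ i, |a t i| ≤ A) (hz : ∀ t < T, ∀ i, |z t i| ≤ R)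
    (hlt : ∀ t < T, ∀ s < t, |a s ⬝ᵥ z t| ≤ η) (hge : ∀ t < T, σ ≤ |a t ⬝ᵥ z t|) :
    (η ^ 2) ^ Fintype.card ι * ((σ / η) ^ 2 / (Fintype.card ι * R ^ 2 + T)) ^ T ≤
      (Fintype.card ι * (η ^ 2 + T * A ^ 2)) ^ Fintype.card ι := by
  classical
  set N := Fintype.card ι with hN
  -- The regularization `η ^ 2` matches the size of the terms `(a s ⬝ᵥ z t) ^ 2`, so `z t` has `V
  -- t`-norm of order `η` although `a t` detects it at level `σ`. Cauchy–Schwarz then makes `a t`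
  -- large for `(V t)⁻¹`, and the rank-one update multiplies the determinant by a large factor.
  let V : ℕ → Matrix ι ι ℝ := fun t =>
    η ^ 2 • (1 : Matrix ι ι ℝ) + ∑ s ∈ range t, Matrix.vecMulVec (a s) (a s)
  have hV : ∀ t, (V t).PosDef := fun t =>
    (Matrix.PosDef.one.smul (by positivity)).add_posSemidef
      (Matrix.posSemidef_sum _ fun s _ => by
        simpa using Matrix.posSemidef_vecMulVec_self_star (a s))
  have hquad : ∀ t z, z ⬝ᵥ (V t).mulVec z = η ^ 2 * (z ⬝ᵥ z) + ∑ s ∈ range t, (a s ⬝ᵥ z) ^ 2 := by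
    intro t z
    simp only [V, Matrix.add_mulVec, dotProduct_add, Matrix.smul_mulVec, Matrix.one_mulVec,
      dotProduct_smul, smul_eq_mul, Matrix.sum_mulVec, dotProduct_sum]
    congr 1
    refine sum_congr rfl fun s _ => ?_
    rw [Matrix.vecMulVec_mulVec, dotProduct_smul, dotProduct_comm z (a s)]
    simp [pow_two]
  have hzz : ∀ t < T, z t ⬝ᵥ z t ≤ N * R ^ 2 := by
    intro t ht
    rw [hN, ← nsmul_eq_mul, ← card_univ]
    refine sum_le_card_nsmul _ _ _ fun i _ => ?_
    rw [← pow_two, ← sq_abs]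
    exact pow_le_pow_left₀ (abs_nonneg _) (hz t ht i) 2
  have hgrow : ∀ t ≤ T,
      (η ^ 2) ^ N * ((σ / η) ^ 2 / (N * R ^ 2 + T)) ^ t ≤ (V t).det := by
    intro t
    induction t with
    | zero =>
      intro _
      simp [V, hN]
    | succ t ih =>
      intro ht
      have htT : t < T := ht
      have hT0 : (0 : ℝ) < T := by exact_mod_cast (by omega : 0 < T)
      have hK : 0 < N * R ^ 2 + T := by positivity
      have hq : z t ⬝ᵥ (V t).mulVec (z t) ≤ η ^ 2 * (N * R ^ 2 + T) := by
        rw [hquad, mul_add]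
        refine add_le_add (mul_le_mul_of_nonneg_left (hzz t htT) (by positivity)) ?_
        have h1 : ∀ s ∈ range t, (a s ⬝ᵥ z t) ^ 2 ≤ η ^ 2 := fun s hs => by
          rw [← sq_abs]
          exact pow_le_pow_left₀ (abs_nonneg _) (hlt t htT s (mem_range.1 hs)) 2
        refine (sum_le_card_nsmul _ _ _ h1).trans ?_
        rw [card_range, nsmul_eq_mul, mul_comm]
        have : (t : ℝ) ≤ T := by exact_mod_cast htT.le
        gcongr
      have hcs := (hV t).sq_dotProduct_le (a t) (z t)
      have hσ2 : σ ^ 2 ≤ (a t ⬝ᵥ z t) ^ 2 := by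
        rw [← sq_abs (a t ⬝ᵥ z t)]
        exact pow_le_pow_left₀ hσ.le (hge t htT) 2
      have hnn : 0 ≤ a t ⬝ᵥ (V t)⁻¹.mulVec (a t) := by
        simpa using (hV t).inv.posSemidef.dotProduct_mulVec_nonneg (a t)
      have hfac : (σ / η) ^ 2 / (N * R ^ 2 + T) ≤ 1 + a t ⬝ᵥ (V t)⁻¹.mulVec (a t) := by
        have h2 : σ ^ 2 ≤ (a t ⬝ᵥ (V t)⁻¹.mulVec (a t)) * (η ^ 2 * (N * R ^ 2 + T)) :=
          hσ2.trans (hcs.trans (mul_le_mul_of_nonneg_left hq hnn))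
        rw [div_pow, div_div, div_le_iff₀ (by positivity)]
        nlinarith [mul_pos (pow_pos hη 2) hK]
      have hstep : V (t + 1) = V t + Matrix.vecMulVec (a t) (a t) := by
        simp only [V, sum_range_succ, add_assoc]
      rw [hstep, Matrix.det_add_vecMulVec_self (isUnit_iff_ne_zero.2 (hV t).det_pos.ne'),
        pow_succ _ t, ← mul_assoc]
      exact mul_le_mul (ih htT.le) hfac (by positivity) (hV t).det_pos.le
  refine (hgrow T le_rfl).trans ?_
  have hentry : ∀ i j, AbsoluteValue.abs (V T i j) ≤ η ^ 2 + T * A ^ 2 := by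
    intro i j
    rw [AbsoluteValue.abs_apply]
    simp only [V, Matrix.add_apply, Matrix.smul_apply, Matrix.sum_apply, Matrix.vecMulVec_apply,
      smul_eq_mul]
    refine (abs_add_le _ _).trans (add_le_add ?_ ?_)
    · rw [Matrix.one_apply]
      split_ifs <;> simp [sq_nonneg]
    · refine (abs_sum_le_sum_abs _ _).trans ?_
      have h1 : ∀ s ∈ range T, |a s i * a s j| ≤ A ^ 2 := fun s hs => by
        rw [abs_mul, pow_two]
        have := ha s (mem_range.1 hs)
        exact mul_le_mul (this i) (this j) (abs_nonneg _) ((abs_nonneg _).trans (this i))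
      refine (sum_le_card_nsmul _ _ _ h1).trans_eq ?_
      rw [card_range, nsmul_eq_mul]
  -- The entries of `V T` are bounded, which caps the growth of its determinant.
  have h := Matrix.det_le hentry
  rw [AbsoluteValue.abs_apply, nsmul_eq_mul] at h
  refine (le_abs_self _).trans (h.trans ?_)
  rw [mul_pow]
  refine mul_le_mul_of_nonneg_right ?_ (by positivity)
  exact_mod_cast Nat.factorial_le_pow N

/-- With `T = 2 * N` rounds the `N`-th root of the potential bound reads `σ ^ 4 / η ^ 2 ≲ 1`. With
only `N` rounds the powers of `η` would cancel. -/
theorem sq_le_of_elliptical_potential {ι : Type*} [Fintype ι] {N : ℕ} (hN : 0 < N)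
    (hcard : Fintype.card ι = N) {a z : ℕ → ι → ℝ} {η σ R : ℝ} (hη : 0 < η) (hη1 : η ≤ 1)
    (hσ : 0 < σ) (ha : ∀ t < 2 * N, ∀ i, |a t i| ≤ 4) (hz : ∀ t < 2 * N, ∀ i, |z t i| ≤ R)
    (hlt : ∀ t < 2 * N, ∀ s < t, |a s ⬝ᵥ z t| ≤ η) (hge : ∀ t < 2 * N, σ ≤ |a t ⬝ᵥ z t|) :
    σ ^ 2 ≤ 6 * N ^ 2 * (R ^ 2 + 2) * η := by
  have h := elliptical_potential hη hσ ha hz hlt hge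
  have hN1 : (1 : ℝ) ≤ N := by exact_mod_cast hN
  rw [hcard, pow_mul, ← mul_pow] at h
  have h1 := le_of_pow_le_pow_left₀ hN.ne' (by positivity) h
  push_cast at h1
  have h2 : (N : ℝ) * (η ^ 2 + 2 * N * 4 ^ 2) ≤ 36 * N ^ 2 := by
    have : η ^ 2 ≤ N := (pow_le_one₀ hη.le hη1).trans hN1
    nlinarith
  have h3 : η ^ 2 * ((σ / η) ^ 2 / (N * R ^ 2 + 2 * N)) ^ 2 =
      (σ ^ 2) ^ 2 / (η * (N * (R ^ 2 + 2))) ^ 2 := by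
    rw [show (N : ℝ) * R ^ 2 + 2 * N = N * (R ^ 2 + 2) by ring]
    field_simp
  rw [h3] at h1
  have h4 := (div_le_iff₀ (by positivity)).1 (h1.trans h2)
  exact (abs_le_of_sq_le_sq' (h4.trans_eq (by ring)) (by positivity)).2

/-! ### Learning by version spaces -/

noncomputable section

/-- The models that remain consistent, up to error `β`, with the first `j` answers, when the `j`-th
query is chosen by `next` from the models consistent with the earlier answers. -/
def versionSpace {n : ℕ} (𝓜 : Set (PreferenceModel n)) (β : ℝ)
    (next : ℕ → Set (PreferenceModel n) → stdSimplex ℝ (Fin n)) (ans : ℕ → Fin n → ℝ) :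
    ℕ → Set (PreferenceModel n)
  | 0 => 𝓜
  | j + 1 => {M ∈ versionSpace 𝓜 β next ans j |
      ‖ans j - normScore M (next j (versionSpace 𝓜 β next ans j))‖ ≤ β}

/-- Extension by zero of a finite list of answers. -/
def extendAnswers {n h : ℕ} (ans : Fin h → Fin n → ℝ) (j : ℕ) : Fin n → ℝ :=
  if hj : j < h then ans ⟨j, hj⟩ else 0

/-- Query according to `next` and output any consistent model. -/
def versionSpaceAlgorithm {n : ℕ} (h : ℕ) (𝓜 : Set (PreferenceModel n)) (β : ℝ)
    (next : ℕ → Set (PreferenceModel n) → stdSimplex ℝ (Fin n)) : QueryAlgorithm n h where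
  query j ans := next j (versionSpace 𝓜 β next (extendAnswers ans) j)
  hypothesis ans :=
    open Classical in
    if hne : (versionSpace 𝓜 β next (extendAnswers ans) h).Nonempty then hne.some else fun _ _ => 1

end

section

variable {n : ℕ} {𝓜 : Set (PreferenceModel n)} {β : ℝ}
  {next : ℕ → Set (PreferenceModel n) → stdSimplex ℝ (Fin n)}

theorem versionSpace_congr {ans ans' : ℕ → Fin n → ℝ} {j : ℕ} (h : ∀ i < j, ans i = ans' i) :
    versionSpace 𝓜 β next ans j = versionSpace 𝓜 β next ans' j := by
  induction j with
  | zero => rfl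
  | succ j ih =>
    simp only [versionSpace]
    rw [ih fun i hi => h i (hi.trans j.lt_succ_self), h j j.lt_succ_self]

theorem versionSpace_antitone (ans : ℕ → Fin n → ℝ) : Antitone (versionSpace 𝓜 β next ans) :=
  antitone_nat_of_succ_le fun _ _ hM => hM.1

theorem norm_sub_normScore_le_of_mem_versionSpace {ans : ℕ → Fin n → ℝ} {M : PreferenceModel n}
    {i j : ℕ} (hM : M ∈ versionSpace 𝓜 β next ans j) (hij : i < j) :
    ‖ans i - normScore M (next i (versionSpace 𝓜 β next ans i))‖ ≤ β :=
  (versionSpace_antitone ans hij hM).2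

theorem mem_of_mem_versionSpace {ans : ℕ → Fin n → ℝ} {M : PreferenceModel n} {j : ℕ}
    (hM : M ∈ versionSpace 𝓜 β next ans j) : M ∈ 𝓜 :=
  versionSpace_antitone ans j.zero_le hM

theorem queryPoint_versionSpaceAlgorithm {h : ℕ} (ans : Fin h → Fin n → ℝ) (j : Fin h) :
    (versionSpaceAlgorithm h 𝓜 β next).queryPoint ans j =
      next j (versionSpace 𝓜 β next (extendAnswers ans) j) := by
  simp only [QueryAlgorithm.queryPoint, versionSpaceAlgorithm]
  rw [versionSpace_congr]
  intro i hi
  simp [extendAnswers, hi, hi.trans j.2]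

theorem mem_versionSpace_of_norm_sub_le {h : ℕ} {ans : Fin h → Fin n → ℝ} {M : PreferenceModel n}
    (hM : M ∈ 𝓜)
    (hans : ∀ j, ‖ans j -
      normScore M ((versionSpaceAlgorithm h 𝓜 β next).queryPoint ans j)‖ ≤ β) {j : ℕ} (hj : j ≤ h) :
    M ∈ versionSpace 𝓜 β next (extendAnswers ans) j := by
  induction j with
  | zero => exact hM
  | succ j ih =>
    refine ⟨ih (by omega), ?_⟩
    have := hans ⟨j, hj⟩
    rw [queryPoint_versionSpaceAlgorithm] at this
    simpa [extendAnswers, show j < h from hj] using this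

/-- Under accurate answers the true model is never discarded, so it and the hypothesis both lie in
the final version space. -/
theorem versionSpaceAlgorithm_learns {h : ℕ} {V : Set (Fin n → ℝ)} {ε : ℝ}
    (hV : ∀ j S, (next j S : Fin n → ℝ) ∈ V) (hpos : ∀ M ∈ 𝓜, ∀ x, 0 < ∑ i, (M x i : ℝ))
    (hclose : ∀ ans, ∀ M ∈ versionSpace 𝓜 β next ans h, ∀ M' ∈ versionSpace 𝓜 β next ans h,
      ∀ x, ‖WithLp.toLp 2 (normScore M x - normScore M' x)‖ ≤ ε) :
    (versionSpaceAlgorithm h 𝓜 β next).Learns 𝓜 V β ε := by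
  refine ⟨fun ans j => ?_, fun M hM ans hans x => ?_⟩
  · rw [queryPoint_versionSpaceAlgorithm]
    exact hV _ _
  · have hmem := mem_versionSpace_of_norm_sub_le hM hans le_rfl
    have hne : (versionSpace 𝓜 β next (extendAnswers ans) h).Nonempty := ⟨M, hmem⟩
    have hhyp : (versionSpaceAlgorithm h 𝓜 β next).hypothesis ans = hne.some := dif_pos hne
    rw [hhyp]
    exact ⟨hpos _ (mem_of_mem_versionSpace hne.some_mem) x,
      hclose _ _ hne.some_mem _ hmem x⟩

end

/-! ### Normalized scores of polynomial models -/

/-- The model has polynomial scores of total degree at most `d` with values in `[lam, 1]`. -/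
def IsPolynomialModel {n : ℕ} (d : ℕ) (lam : ℝ) (M : PreferenceModel n) : Prop :=
  ∃ f : Fin n → MvPolynomial (Fin n) ℝ, (∀ i, (f i).totalDegree ≤ d) ∧
    ∀ (v : stdSimplex ℝ (Fin n)) (i : Fin n),
      lam ≤ (M v i : ℝ) ∧ (M v i : ℝ) = MvPolynomial.eval (v : Fin n → ℝ) (f i)

theorem isPolynomialModel_of_mem_classBMLP {n d : ℕ} {lam : ℝ} {M : PreferenceModel n}
    (hM : M ∈ classBMLP n d lam) : IsPolynomialModel d lam M := by
  obtain ⟨f, hf, h⟩ := hM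
  exact ⟨f, fun i => (hf i).1, fun v i => ⟨(h v i).2 ▸ (h v i).1.1, (h v i).2⟩⟩

theorem isPolynomialModel_of_mem_classBNMP {n d : ℕ} {lam : ℝ} {M : PreferenceModel n}
    (hM : M ∈ classBNMP n d lam) : IsPolynomialModel d lam M := by
  obtain ⟨f, hf, h, -⟩ := hM
  exact ⟨f, hf, fun v i => ⟨(h v i).2 ▸ (h v i).1.1, (h v i).2⟩⟩

section

variable {n d : ℕ} {lam : ℝ} {M M' : PreferenceModel n}

theorem IsPolynomialModel.one_le_sum (hn : 1 ≤ n) (hlam : 1 / (n : ℝ) ≤ lam)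
    (hM : IsPolynomialModel d lam M) (v : stdSimplex ℝ (Fin n)) : 1 ≤ ∑ i, (M v i : ℝ) := by
  obtain ⟨f, -, hf⟩ := hM
  have hn0 : (n : ℝ) ≠ 0 := by positivity
  calc (1 : ℝ) = ∑ _i : Fin n, 1 / (n : ℝ) := by simp [hn0]
    _ ≤ _ := sum_le_sum fun i _ => hlam.trans (hf v i).1

theorem sum_scores_le (v : stdSimplex ℝ (Fin n)) : ∑ i, (M v i : ℝ) ≤ n := by
  calc ∑ i, (M v i : ℝ) ≤ ∑ _i : Fin n, (1 : ℝ) := sum_le_sum fun i _ => (M v i).2.2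
    _ = n := by simp

theorem normScore_mem_Icc (v : stdSimplex ℝ (Fin n)) (i : Fin n) :
    normScore M v i ∈ Set.Icc (0 : ℝ) 1 := by
  have h0 : ∀ j, 0 ≤ (M v j : ℝ) := fun j => (M v j).2.1
  exact ⟨div_nonneg (h0 i) (sum_nonneg fun j _ => h0 j),
    div_le_one_of_le₀ (single_le_sum (f := fun j => (M v j : ℝ)) (fun j _ => h0 j) (mem_univ i))
      (sum_nonneg fun j _ => h0 j)⟩

theorem norm_toLp_le_mul_of_abs_le {w : Fin n → ℝ} {B : ℝ} (hB : 0 ≤ B) (hw : ∀ i, |w i| ≤ B) :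
    ‖WithLp.toLp 2 w‖ ≤ n * B := by
  rw [EuclideanSpace.norm_eq, Real.sqrt_le_iff]
  refine ⟨by positivity, ?_⟩
  calc ∑ i, ‖w i‖ ^ 2 ≤ ∑ _i : Fin n, B ^ 2 :=
        sum_le_sum fun i _ => pow_le_pow_left₀ (norm_nonneg _) (hw i) 2
    _ = n * B ^ 2 := by simp
    _ ≤ n ^ 2 * B ^ 2 := by
        have : (n : ℝ) ≤ n ^ 2 := by exact_mod_cast Nat.le_self_pow two_ne_zero n
        gcongr
    _ = _ := by ring

theorem norm_toLp_normScore_sub_le_two (x : stdSimplex ℝ (Fin n)) :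
    ‖WithLp.toLp 2 (normScore M x - normScore M' x)‖ ≤ 2 := by
  have h : ∀ M : PreferenceModel n, ‖WithLp.toLp 2 (normScore M x)‖ ≤ 1 := by
    intro M
    have h0 := normScore_mem_Icc (M := M) x
    rw [EuclideanSpace.norm_eq, Real.sqrt_le_iff]
    refine ⟨one_pos.le, ?_⟩
    calc ∑ i, ‖normScore M x i‖ ^ 2 ≤ ∑ i, normScore M x i := by
          refine sum_le_sum fun i _ => ?_
          rw [Real.norm_of_nonneg (h0 i).1]
          nlinarith [(h0 i).1, (h0 i).2]
      _ ≤ 1 ^ 2 := by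
          simp only [normScore, ← sum_div, one_pow]
          exact div_self_le_one _
  rw [WithLp.toLp_sub]
  exact (norm_sub_le _ _).trans (by linarith [h M, h M'])

theorem normScore_eq_of_subsingleton [Subsingleton (Fin n)] {x : stdSimplex ℝ (Fin n)}
    (hM : 0 < ∑ i, (M x i : ℝ)) (hM' : 0 < ∑ i, (M' x i : ℝ)) :
    normScore M x = normScore M' x := by
  ext i
  have : ∀ g : Fin n → ℝ, ∑ j, g j = g i := fun g =>
    Fintype.sum_eq_single i fun j hj => absurd (Subsingleton.elim j i) hj
  rw [this] at hM hM'
  rw [normScore, normScore, this fun j => (M x j : ℝ), this fun j => (M' x j : ℝ),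
    div_self hM.ne', div_self hM'.ne']

theorem radius_le_of_localBall_subset {α : ℝ} (hn : 2 ≤ n) (hα : 0 < α)
    (h : localBall (uniformVector n) α ⊆ stdSimplex ℝ (Fin n)) : α ≤ 2 / n := by
  let i : Fin n := ⟨0, by omega⟩
  let j : Fin n := ⟨1, by omega⟩
  have hij : i ≠ j := by simp [i, j]
  have hn0 : (n : ℝ) ≠ 0 := by positivity
  -- Moving mass `α / 2` from `j` to `i` stays in the ball, and coordinate `j` must remain
  -- nonnegative.
  have hv : uniformVector n + (Pi.single i (α / 2) - Pi.single j (α / 2)) ∈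
      localBall (uniformVector n) α := by
    refine ⟨?_, ?_⟩
    · simp [uniformVector, sum_add_distrib, sum_sub_distrib, hn0]
    · rw [add_sub_cancel_left, WithLp.toLp_sub]
      refine (norm_sub_le _ _).trans ?_
      have : ∀ i : Fin n, ‖WithLp.toLp 2 (Pi.single i (α / 2) : Fin n → ℝ)‖ = α / 2 := by
        intro i
        exact (PiLp.norm_single 2 (fun _ => ℝ) i (α / 2)).trans (Real.norm_of_nonneg (by linarith))
      rw [this, this]
      linarith
  have := (h hv).1 j
  simp [uniformVector, hij.symm] at this
  rw [div_eq_mul_inv]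
  linarith

/-- Cross-multiplying turns the difference of scores into a polynomial `G` of degree at most `2 *
d`. The factor relating them, the product of the two total scores, lies in `[1, n ^ 2]`. -/
theorem abs_normScore_sub_le_of_localBall {α γ : ℝ} (hn : 1 ≤ n) (hα : 0 < α) (hα1 : α ≤ 1)
    (hlam : 1 / (n : ℝ) ≤ lam) (hM : IsPolynomialModel d lam M) (hM' : IsPolynomialModel d lam M')
    (hsub : localBall (uniformVector n) α ⊆ stdSimplex ℝ (Fin n)) (i : Fin n)
    (hγ : ∀ v : stdSimplex ℝ (Fin n), (v : Fin n → ℝ) ∈ localBall (uniformVector n) α →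
      |normScore M v i - normScore M' v i| ≤ γ) (x : stdSimplex ℝ (Fin n)) :
    |normScore M x i - normScore M' x i| ≤
      (2 * d + 1) * (2 * d / α) ^ (2 * d) * (γ * n ^ 2) := by
  have h1 := hM.one_le_sum hn hlam
  have h1' := hM'.one_le_sum hn hlam
  obtain ⟨f, hfd, hf⟩ := hM
  obtain ⟨f', hfd', hf'⟩ := hM'
  let G := f i * ∑ j, f' j - f' i * ∑ j, f j
  have hsum : ∀ g : Fin n → MvPolynomial (Fin n) ℝ, (∀ i, (g i).totalDegree ≤ d) →
      (∑ j, g j).totalDegree ≤ d := fun g hg =>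
    MvPolynomial.totalDegree_finsetSum_le fun j _ => hg j
  have hG : G.totalDegree ≤ 2 * d := by
    refine (MvPolynomial.totalDegree_sub _ _).trans (max_le ?_ ?_)
    · refine (MvPolynomial.totalDegree_mul _ _).trans ?_
      linarith [hfd i, hsum f' hfd']
    · refine (MvPolynomial.totalDegree_mul _ _).trans ?_
      linarith [hfd' i, hsum f hfd]
  have hGv : ∀ v : stdSimplex ℝ (Fin n), MvPolynomial.eval (v : Fin n → ℝ) G =
      (normScore M v i - normScore M' v i) * ((∑ j, (M v j : ℝ)) * ∑ j, (M' v j : ℝ)) := by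
    intro v
    have a1 := (one_pos.trans_le (h1 v)).ne'
    have a2 := (one_pos.trans_le (h1' v)).ne'
    simp only [G, map_sub, map_mul, map_sum, ← (hf v _).2, ← (hf' v _).2, normScore]
    field_simp
  have hx := abs_eval_le_of_abs_eval_localBall_le hn hG hα hα1 (B := γ * n ^ 2) (fun v hv => by
    have := hγ ⟨v, hsub hv⟩ hv
    change |MvPolynomial.eval (⇑(⟨v, hsub hv⟩ : stdSimplex ℝ (Fin n))) G| ≤ _
    rw [hGv, abs_mul, pow_two]
    refine mul_le_mul this ?_ (abs_nonneg _) ((abs_nonneg _).trans this)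
    have b1 := one_pos.le.trans (h1 ⟨v, hsub hv⟩)
    have b2 := one_pos.le.trans (h1' ⟨v, hsub hv⟩)
    rw [abs_of_nonneg (mul_nonneg b1 b2)]
    exact mul_le_mul (sum_scores_le _) (sum_scores_le _) b2 (Nat.cast_nonneg n)) x.2
  change |MvPolynomial.eval (⇑x) G| ≤ _ at hx
  rw [hGv x, abs_mul] at hx
  push_cast at hx
  refine le_trans ?_ hx
  refine le_mul_of_one_le_right (abs_nonneg _) (le_trans ?_ (le_abs_self _))
  exact one_le_mul_of_one_le_of_one_le (h1 x) (h1' x)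

theorem isCompact_localBall {vstar : Fin n → ℝ} {α : ℝ}
    (hsub : localBall vstar α ⊆ stdSimplex ℝ (Fin n)) : IsCompact (localBall vstar α) := by
  refine (isCompact_stdSimplex ℝ (Fin n)).of_isClosed_subset ?_ hsub
  refine IsClosed.inter (s₁ := {v : Fin n → ℝ | ∑ i, v i = 1})
    (s₂ := {v : Fin n → ℝ | ‖WithLp.toLp 2 (v - vstar)‖ ≤ α}) ?_ ?_
  · exact isClosed_eq (by fun_prop) continuous_const
  · exact isClosed_le (by fun_prop) continuous_const

theorem uniformVector_mem_localBall {α : ℝ} (hn : 1 ≤ n) (hα : 0 ≤ α) :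
    uniformVector n ∈ localBall (uniformVector n) α := by
  have hn0 : (n : ℝ) ≠ 0 := by positivity
  exact ⟨by simp [uniformVector, hn0], by simpa using hα⟩

end

/-! ### Reduction to closeness of consistent models -/

theorem localBall_one_div_subset_classEIRD {n d k : ℕ} {lam : ℝ} (hn : 1 ≤ n) (hk : 1 ≤ k)
    (hlam : (k : ℝ) ^ 2 / n ≤ lam) (hlam1 : lam ≤ 1) {𝓜 : Set (PreferenceModel n)}
    (hpoly : ∀ M ∈ 𝓜, IsPolynomialModel d lam M) :
    localBall (uniformVector n) (1 / n) ⊆ classEIRD k 𝓜 := by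
  intro x hx
  have h : ∀ M : PreferenceModel n, (∀ v i, lam ≤ (M v i : ℝ)) →
      x ∈ stdSimplex ℝ (Fin n) ∧ x ∈ EIRD k M := fun M hM =>
    localBall_subset_EIRD hn hk hlam hlam1 hM hx
  refine ⟨(h (fun _ _ => 1) fun _ _ => hlam1).1, fun M hM => (h M fun v i => ?_).2⟩
  obtain ⟨f, -, hf⟩ := hpoly M hM
  exact (hf v i).1

/-- For `n = 1` every normalized score is `1`. For `n ≥ 2` a ball inside the simplex has radius at
most `2 / n`, so only such `α` matter. -/
theorem isLocallyLearnableAround_of_versionSpace {n d k h : ℕ} {lam : ℝ} (hn : 1 ≤ n) (hk : 1 ≤ k)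
    (hlam : (k : ℝ) ^ 2 / n ≤ lam) (hlam1 : lam ≤ 1) {𝓜 : Set (PreferenceModel n)}
    (hpoly : ∀ M ∈ 𝓜, IsPolynomialModel d lam M) {B : ℝ → ℝ → ℝ}
    (hlearn : 2 ≤ n → ∀ α : ℝ, 0 < α → α ≤ 2 / n →
      localBall (uniformVector n) α ⊆ stdSimplex ℝ (Fin n) → ∀ ε > 0, ∀ β ≥ 0, β ≤ B ε α →
      ∃ next : ℕ → Set (PreferenceModel n) → stdSimplex ℝ (Fin n),
        (∀ j S, (next j S : Fin n → ℝ) ∈ localBall (uniformVector n) α) ∧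
        ∀ ans, ∀ M ∈ versionSpace 𝓜 β next ans h, ∀ M' ∈ versionSpace 𝓜 β next ans h,
          ∀ x, ‖WithLp.toLp 2 (normScore M x - normScore M' x)‖ ≤ ε) :
    IsLocallyLearnableAround k h 𝓜 (uniformVector n) B := by
  have hpos : ∀ M ∈ 𝓜, ∀ x, 0 < ∑ i, (M x i : ℝ) := fun M hM x =>
    one_pos.trans_le ((hpoly M hM).one_le_sum hn (one_div_le_of_sq_div_le hk hlam) x)
  have hball := localBall_one_div_subset_classEIRD hn hk hlam hlam1 hpoly
  refine ⟨hball (uniformVector_mem_localBall hn (by positivity)),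
    ⟨1 / n, by positivity, hball⟩, fun α hα hsub ε hε β hβ hβB => ?_⟩
  have hsub' : localBall (uniformVector n) α ⊆ stdSimplex ℝ (Fin n) := fun v hv => (hsub hv).1
  rcases hn.eq_or_lt with rfl | hn2
  · have hu := uniformVector_mem_localBall le_rfl hα.le
    refine ⟨_, versionSpaceAlgorithm_learns (next := fun _ _ => ⟨_, hsub' hu⟩) (fun _ _ => hu) hpos
      fun ans M hM M' hM' x => ?_⟩
    rw [normScore_eq_of_subsingleton (hpos M (mem_of_mem_versionSpace hM) x)
      (hpos M' (mem_of_mem_versionSpace hM') x), sub_self]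
    simpa using hε.le
  · obtain ⟨next, hV, hclose⟩ := hlearn hn2 α hα
      (radius_le_of_localBall_subset hn2 hα hsub') hsub' ε hε β hβ hβB
    exact ⟨_, versionSpaceAlgorithm_learns hV hpos hclose⟩

/-! ### Normalized models: nonadaptive queries -/

/-- Two consistent models differ by at most `2 * β` at each node, hence by `n ^ d * (2 * β)` on the
ball; extrapolation in degree `d` and the passage to the Euclidean norm give the remaining factors.
-/
theorem exists_next_of_mem_classBNMP {n d : ℕ} {lam α ε β : ℝ} (hn : 1 ≤ n)
    (hα : 0 < α) (hα1 : α ≤ 1)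
    (hsub : localBall (uniformVector n) α ⊆ stdSimplex ℝ (Fin n)) (hβ : 0 ≤ β)
    (hβε : n * ((d + 1) * (d / α) ^ d * (n ^ d * (2 * β))) ≤ ε) :
    ∃ next : ℕ → Set (PreferenceModel n) → stdSimplex ℝ (Fin n),
      (∀ j S, (next j S : Fin n → ℝ) ∈ localBall (uniformVector n) α) ∧
      ∀ ans, ∀ M ∈ versionSpace (classBNMP n d lam) β next ans (n ^ d),
        ∀ M' ∈ versionSpace (classBNMP n d lam) β next ans (n ^ d),
        ∀ x, ‖WithLp.toLp 2 (normScore M x - normScore M' x)‖ ≤ ε := by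
  have hu := uniformVector_mem_localBall hn hα.le
  obtain ⟨q, l, hq, hl, hql⟩ := exists_polynomial_interpolation_nodes (d := d)
    (isCompact_localBall hsub) ⟨_, hu⟩ fun v hv => hv.1
  let next : ℕ → Set (PreferenceModel n) → stdSimplex ℝ (Fin n) := fun j _ =>
    if hj : j < n ^ d then ⟨q ⟨j, hj⟩, hsub (hq _)⟩ else ⟨_, hsub hu⟩
  have hnext : ∀ (j : Fin (n ^ d)) S, next j S = ⟨q j, hsub (hq j)⟩ := fun j S => dif_pos j.2
  refine ⟨next, fun j S => ?_, fun ans M hM M' hM' x => ?_⟩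
  · simp only [next]
    split_ifs
    · exact hq _
    · exact hu
  · have key : ∀ M ∈ classBNMP n d lam, ∃ g : Fin n → MvPolynomial (Fin n) ℝ,
        (∀ i, (g i).totalDegree ≤ d) ∧ ∀ (v : stdSimplex ℝ (Fin n)) i,
          MvPolynomial.eval (⇑v) (g i) = normScore M v i := by
      rintro M ⟨f, hfd, hf, c, hc⟩
      refine ⟨fun i => MvPolynomial.C c⁻¹ * f i, fun i => ?_, fun v i => ?_⟩
      · refine (MvPolynomial.totalDegree_mul _ _).trans ?_
        rw [MvPolynomial.totalDegree_C, zero_add]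
        exact hfd i
      · simp only [normScore, (hf v _).2, hc v, map_mul, MvPolynomial.eval_C]
        rw [div_eq_mul_inv, mul_comm]
    obtain ⟨g, hgd, hg⟩ := key M (mem_of_mem_versionSpace hM)
    obtain ⟨g', hgd', hg'⟩ := key M' (mem_of_mem_versionSpace hM')
    refine (norm_toLp_le_mul_of_abs_le (B := (d + 1) * (d / α) ^ d * (n ^ d * (2 * β)))
      (by positivity) fun i => ?_).trans hβε
    have hdeg : (g i - g' i).totalDegree ≤ d :=
      (MvPolynomial.totalDegree_sub _ _).trans (max_le (hgd i) (hgd' i))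
    have hx := abs_eval_le_of_abs_eval_localBall_le hn hdeg hα hα1 (B := n ^ d * (2 * β))
      (fun v hv => ?_) x.2
    · change |MvPolynomial.eval (⇑x) _| ≤ _ at hx
      rwa [map_sub, hg, hg'] at hx
    · rw [hql _ hdeg v hv]
      refine (abs_sum_le_sum_abs _ _).trans ?_
      refine (sum_le_card_nsmul _ _ (2 * β) fun j _ => ?_).trans_eq (by simp)
      rw [abs_mul]
      refine (mul_le_of_le_one_left (abs_nonneg _) (hl j v hv)).trans ?_
      have h1 := norm_sub_normScore_le_of_mem_versionSpace hM j.2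
      have h2 := norm_sub_normScore_le_of_mem_versionSpace hM' j.2
      rw [hnext j (versionSpace (classBNMP n d lam) β next ans j)] at h1 h2
      have h1 := (norm_le_pi_norm _ i).trans h1
      have h2 := (norm_le_pi_norm _ i).trans h2
      change |MvPolynomial.eval (⇑(⟨q j, hsub (hq j)⟩ : stdSimplex ℝ (Fin n))) _| ≤ _
      rw [map_sub, hg, hg']
      rw [Real.norm_eq_abs, Pi.sub_apply, abs_le] at h1 h2
      rw [abs_le]
      constructor <;> linarith [h1.1, h1.2, h2.1, h2.2]

/-- Writing `n + 1` for `n` in the denominator keeps it positive at `n = 0` as well. -/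
theorem isLocallyLearnableAround_classBNMP {n d k : ℕ} {lam : ℝ} (hn : 1 ≤ n) (hk : 1 ≤ k)
    (hlam : (k : ℝ) ^ 2 / n ≤ lam) (hlam1 : lam ≤ 1) :
    IsLocallyLearnableAround k (1 * n ^ d) (classBNMP n d lam) (uniformVector n)
      fun ε α => ε * α ^ d / (2 * (n + 1) ^ (d + 1) * (d + 1) * d ^ d) := by
  rw [one_mul]
  refine isLocallyLearnableAround_of_versionSpace hn hk hlam hlam1
    (fun M => isPolynomialModel_of_mem_classBNMP) fun hn2 α hα hα2 hsub ε hε β hβ hβB => ?_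
  have hα1 : α ≤ 1 := by
    refine hα2.trans ?_
    rw [div_le_one (by positivity)]
    exact_mod_cast hn2
  refine exists_next_of_mem_classBNMP hn hα hα1 hsub hβ ?_
  have hd : (0 : ℝ) < d ^ d := by
    rcases d.eq_zero_or_pos with rfl | hd
    · simp
    · positivity
  rw [le_div_iff₀ (by positivity)] at hβB
  have hpow : (n : ℝ) ^ (d + 1) ≤ (n + 1) ^ (d + 1) := by gcongr; linarith
  have h1 : β * (2 * n ^ (d + 1) * (d + 1) * d ^ d) ≤ ε * α ^ d :=
    le_trans (by gcongr) hβB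
  calc n * ((d + 1) * (d / α) ^ d * (n ^ d * (2 * β)))
      = β * (2 * n ^ (d + 1) * (d + 1) * d ^ d) / α ^ d := by
        rw [div_pow]
        field_simp
        ring
    _ ≤ ε := by
        rw [div_le_iff₀ (by positivity)]
        exact h1

/-! ### Models with varying total score: adaptive queries -/

theorem exists_next_of_isPolynomialModel {n d : ℕ} {𝓜 : Set (PreferenceModel n)}
    {lam α β B γ : ℝ} (hn : 1 ≤ n) (hlam : 1 / (n : ℝ) ≤ lam) (hα : 0 < α)
    (hsub : localBall (uniformVector n) α ⊆ stdSimplex ℝ (Fin n))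
    (hpoly : ∀ M ∈ 𝓜, IsPolynomialModel d lam M) (hβB : β ≤ B) (hB : 0 < B)
    (hγ : 0 < γ) (hγ1 : γ ≤ 1) (hBγ : 576 * ((n : ℝ) ^ d) ^ 3 * n ^ 3 * B < γ ^ 2) :
    ∃ next : ℕ → Set (PreferenceModel n) → stdSimplex ℝ (Fin n),
      (∀ j S, (next j S : Fin n → ℝ) ∈ localBall (uniformVector n) α) ∧
      ∀ ans, ∀ M ∈ versionSpace 𝓜 β next ans (3 * n ^ d),
        ∀ M' ∈ versionSpace 𝓜 β next ans (3 * n ^ d),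
        ∀ v : stdSimplex ℝ (Fin n), (v : Fin n → ℝ) ∈ localBall (uniformVector n) α →
          ∀ i, |normScore M v i - normScore M' v i| ≤ γ := by
  classical
  have hu := uniformVector_mem_localBall hn hα.le
  have hnodes := exists_polynomial_interpolation_nodes (d := d)
    (isCompact_localBall hsub) ⟨_, hu⟩ fun v hv => hv.1
  have hN0 : 0 < n ^ d := by positivity
  rw [← Nat.cast_pow] at hBγ
  generalize n ^ d = N at *
  obtain ⟨q, l, hq, hl, hql⟩ := hnodes
  have hN1 : (1 : ℝ) ≤ N := by exact_mod_cast hN0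
  have hn1 : (1 : ℝ) ≤ n := by exact_mod_cast hn
  let Q : Fin N → stdSimplex ℝ (Fin n) := fun j => ⟨q j, hsub (hq j)⟩
  let bad : Set (PreferenceModel n) → stdSimplex ℝ (Fin n) → Prop := fun S v =>
    (v : Fin n → ℝ) ∈ localBall (uniformVector n) α ∧
      ∃ M ∈ S, ∃ M' ∈ S, ∃ i, γ < |normScore M v i - normScore M' v i|
  -- The `N` nodes come first, then points where consistent models disagree; the uniform vector is a
  -- filler when there are none.
  let next : ℕ → Set (PreferenceModel n) → stdSimplex ℝ (Fin n) := fun j S =>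
    if hj : j < N then Q ⟨j, hj⟩
    else if hS : ∃ v, bad S v then hS.choose else ⟨_, hsub hu⟩
  have hnode : ∀ (j : Fin N) S, next j S = Q j := fun j S => dif_pos j.2
  have hnextV : ∀ j S, (next j S : Fin n → ℝ) ∈ localBall (uniformVector n) α := by
    intro j S
    simp only [next]
    split_ifs with h1 h2
    · exact hq _
    · exact h2.choose_spec.1
    · exact hu
  refine ⟨next, hnextV, fun ans M hM M' hM' v hv i => ?_⟩
  -- Version spaces only shrink, so a final disagreement means that every adaptive round had a
  -- disagreement to query.
  by_contra! hlt
  set vs := versionSpace 𝓜 β next ans with hvs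
  let pt : ℕ → stdSimplex ℝ (Fin n) := fun j => next j (vs j)
  have hcons : ∀ P j m, P ∈ vs m → j < m → ∀ i, |ans j i - normScore P (pt j) i| ≤ β := by
    intro P j m hP hj i
    exact (norm_le_pi_norm _ i).trans (norm_sub_normScore_le_of_mem_versionSpace hP hj)
  -- at every adaptive round some model that is still consistent is refuted by the answer
  have hround : ∀ t, ∃ (P : PreferenceModel n) (i : Fin n), t < 2 * N →
      P ∈ vs (N + t) ∧ γ / 2 ≤ |ans (N + t) i - normScore P (pt (N + t)) i| := by
    intro t
    by_cases ht : t < 2 * N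
    · have hle : N + t ≤ 3 * N := by omega
      have hbad : ∃ v, bad (vs (N + t)) v :=
        ⟨v, hv, M, versionSpace_antitone ans hle hM, M', versionSpace_antitone ans hle hM', i, hlt⟩
      have hpt : pt (N + t) = hbad.choose := by
        simp only [pt, next]
        rw [dif_neg (by omega), dif_pos hbad]
      obtain ⟨-, P, hP, P', hP', i, hi⟩ := hbad.choose_spec
      rw [← hpt] at hi
      by_cases h : γ / 2 ≤ |ans (N + t) i - normScore P (pt (N + t)) i|
      · exact ⟨P, i, fun _ => ⟨hP, h⟩⟩
      · refine ⟨P', i, fun _ => ⟨hP', ?_⟩⟩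
        have := abs_sub_le (normScore P (pt (N + t)) i) (ans (N + t) i)
          (normScore P' (pt (N + t)) i)
        rw [abs_sub_comm (normScore P (pt (N + t)) i) (ans (N + t) i)] at this
        linarith [not_le.1 h]
    · exact ⟨M, i, fun h => absurd h ht⟩
  choose P ι hPι using hround
  let F : PreferenceModel n → stdSimplex ℝ (Fin n) → ℝ := fun P v => ∑ i, (P v i : ℝ)
  let z : ℕ → Fin N → ℝ := fun t j => F (P t) (Q j)
  -- Interpolating both `f_i` and `F` at the new point, with `f_i ≈ answer * F` at the nodes, gives
  -- `F * (answer - score) ≈ a t ⬝ᵥ z s`.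
  let a : ℕ → Fin N → ℝ := fun t j => (ans (N + t) (ι t) - ans j (ι t)) * l j (pt (N + t))
  have hF1 : ∀ t < 2 * N, ∀ v, 1 ≤ F (P t) v := fun t ht v =>
    (hpoly _ (mem_of_mem_versionSpace (hPι t ht).1)).one_le_sum hn hlam v
  have hFn : ∀ P v, F P v ≤ n := fun P v => sum_scores_le v
  have hscale : ∀ t < 2 * N, ∀ v i, (P t v i : ℝ) = F (P t) v * normScore (P t) v i := by
    intro t ht v i
    have := (one_pos.trans_le (hF1 t ht v)).ne'
    simp only [normScore, F] at this ⊢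
    field_simp
  have hinterp : ∀ s < 2 * N, ∀ t, |a t ⬝ᵥ z s - F (P s) (pt (N + t)) *
      (ans (N + t) (ι t) - normScore (P s) (pt (N + t)) (ι t))| ≤ N * (n * β) := by
    intro s hs t
    obtain ⟨f, hfd, hf⟩ := hpoly _ (mem_of_mem_versionSpace (hPι s hs).1)
    have hev : ∀ g : MvPolynomial (Fin n) ℝ, g.totalDegree ≤ d →
        MvPolynomial.eval (⇑(pt (N + t))) g =
          ∑ j, l j (pt (N + t)) * MvPolynomial.eval (⇑(Q j)) g := fun g hg =>
      hql g hg _ (hnextV _ _)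
    have hF : F (P s) (pt (N + t)) = ∑ j, l j (pt (N + t)) * F (P s) (Q j) := by
      have := hev (∑ i, f i) (MvPolynomial.totalDegree_finsetSum_le fun i _ => hfd i)
      simpa only [map_sum, ← (hf _ _).2] using this
    have hf' := hev (f (ι t)) (hfd _)
    simp only [← (hf _ _).2] at hf'
    rw [mul_sub, ← hscale s hs, hf', hF, sum_mul, ← sum_sub_distrib, dotProduct,
      ← sum_sub_distrib]
    refine (abs_sum_le_sum_abs _ _).trans ?_
    refine (sum_le_card_nsmul _ _ (n * β) fun j _ => ?_).trans_eq (by simp)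
    have hj := hcons (P s) j _ (hPι s hs).1 (by omega) (ι t)
    rw [show pt j = Q j from hnode j (vs j)] at hj
    have heq : a t j * z s j - (l j (pt (N + t)) * F (P s) (Q j) * ans (N + t) (ι t) -
        l j (pt (N + t)) * (P s (Q j) (ι t) : ℝ)) =
        -(l j (pt (N + t))) *
          (F (P s) (Q j) * (ans j (ι t) - normScore (P s) (Q j) (ι t))) := by
      rw [hscale s hs]
      ring
    rw [heq, abs_mul, abs_neg, abs_mul, abs_of_pos (one_pos.trans_le (hF1 s hs _))]
    refine (mul_le_of_le_one_left (mul_nonneg (one_pos.le.trans (hF1 s hs _)) (abs_nonneg _))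
      (hl j _ (hnextV _ _))).trans ?_
    exact mul_le_mul (hFn _ _) hj (abs_nonneg _) (by positivity)
  have hNnB : 576 * (N * (n * B)) < γ ^ 2 := by
    refine lt_of_le_of_lt ?_ hBγ
    have h1 : (N : ℝ) ≤ N ^ 3 := le_self_pow₀ hN1 three_ne_zero
    have h2 : (n : ℝ) ≤ n ^ 3 := le_self_pow₀ hn1 three_ne_zero
    calc 576 * (N * (n * B)) = 576 * N * n * B := by ring
      _ ≤ _ := by gcongr
  have hγ2 : γ ^ 2 ≤ γ := by nlinarith
  have hnβ : n * β ≤ N * (n * B) := by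
    have : n * β ≤ n * B := by gcongr
    nlinarith [mul_pos (one_pos.trans_le hn1) hB]
  have hNnβ : N * (n * β) ≤ N * (n * B) := by gcongr
  have hnn : 0 < N * (n * B) := by positivity
  have hans : ∀ j < 3 * N, ∀ i, |ans j i| ≤ 2 := by
    intro j hj i
    have h1 := abs_le.1 (hcons M j _ hM hj i)
    have h2 := normScore_mem_Icc (M := M) (pt j) i
    have h3 : β ≤ 1 := by nlinarith
    rw [abs_le]
    constructor <;> linarith [h1.1, h1.2, h2.1, h2.2]
  -- `η` adds the interpolation error `N * n * β` and the consistency error `n * β`; using `B` in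
  -- place of `β` keeps it positive. The detection level `γ / 2` minus the interpolation error is
  -- still `γ / 4`. The outcome `γ ^ 2 ≤ 576 * N ^ 3 * n ^ 3 * B`, with `576 = 16 * 6 * 3 * 2`,
  -- contradicts `hBγ`.
  have hfinal := sq_le_of_elliptical_potential hN0 (Fintype.card_fin N) (a := a) (z := z)
    (η := 2 * (N * (n * B))) (σ := γ / 4) (R := n) (by positivity) (by linarith) (by positivity)
    ?_ ?_ ?_ ?_
  · have h1 : (n : ℝ) ^ 2 + 2 ≤ 3 * n ^ 2 := by nlinarith
    have h2 : 6 * (N : ℝ) ^ 2 * (n ^ 2 + 2) * (2 * (N * (n * B))) ≤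
        6 * (N : ℝ) ^ 2 * (3 * n ^ 2) * (2 * (N * (n * B))) := by gcongr
    nlinarith
  · intro t ht j
    simp only [a]
    rw [abs_mul]
    refine (mul_le_of_le_one_right (abs_nonneg _) (hl j _ (hnextV _ _))).trans ?_
    refine (abs_sub _ _).trans ?_
    linarith [hans (N + t) (by omega) (ι t), hans j (by omega) (ι t)]
  · intro t ht j
    simp only [z]
    rw [abs_of_pos (one_pos.trans_le (hF1 t ht _))]
    exact hFn _ _
  · intro t ht s hst
    have h1 := hcons (P t) (N + s) _ (hPι t ht).1 (by omega) (ι s)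
    have h2 : |F (P t) (pt (N + s)) *
        (ans (N + s) (ι s) - normScore (P t) (pt (N + s)) (ι s))| ≤ n * β := by
      rw [abs_mul, abs_of_pos (one_pos.trans_le (hF1 t ht _))]
      exact mul_le_mul (hFn _ _) h1 (abs_nonneg _) (by positivity)
    have h3 := hinterp t ht s
    rw [abs_le] at h2 h3 ⊢
    constructor <;> linarith [h2.1, h2.2, h3.1, h3.2]
  · intro t ht
    have h1 := (hPι t ht).2
    have h2 : γ / 2 ≤ |F (P t) (pt (N + t)) *
        (ans (N + t) (ι t) - normScore (P t) (pt (N + t)) (ι t))| := by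
      rw [abs_mul, abs_of_pos (one_pos.trans_le (hF1 t ht _))]
      nlinarith [hF1 t ht (pt (N + t))]
    have h3 := hinterp t ht t
    rw [abs_sub_comm] at h3
    have h4 := (abs_sub_abs_le_abs_sub _ _).trans h3
    linarith

theorem isLocallyLearnableAround_classBMLP {n d k : ℕ} {lam : ℝ} (hn : 1 ≤ n) (hk : 1 ≤ k)
    (hlam : (k : ℝ) ^ 2 / n ≤ lam) (hlam1 : lam ≤ 1) :
    IsLocallyLearnableAround k (3 * n ^ d) (classBMLP n d lam) (uniformVector n)
      fun ε α => 1 / 2500 * ε ^ 2 / ((n : ℝ) * ((d : ℝ) / α) ^ d) ^ 25 := by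
  refine isLocallyLearnableAround_of_versionSpace hn hk hlam hlam1
    (fun M => isPolynomialModel_of_mem_classBMLP) fun hn2 α hα hα2 hsub ε hε β hβ hβB => ?_
  have hn2' : (2 : ℝ) ≤ n := by exact_mod_cast hn2
  have hα1 : α ≤ 1 := by
    refine hα2.trans ?_
    rwa [div_le_one (by positivity)]
  have hlam' := one_div_le_of_sq_div_le hk hlam
  have hpoly : ∀ M ∈ classBMLP n d lam, IsPolynomialModel d lam M := fun M =>
    isPolynomialModel_of_mem_classBMLP
  have hu := uniformVector_mem_localBall hn hα.le
  rcases le_or_gt 2 ε with hε2 | hε2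
  · exact ⟨fun _ _ => ⟨_, hsub hu⟩, fun _ _ => hu, fun _ _ _ _ _ x =>
      (norm_toLp_normScore_sub_le_two x).trans hε2⟩
  -- every factor below is bounded by a power of `Y`
  set y : ℝ := ((d : ℝ) / α) ^ d with hy
  set Y : ℝ := n * y with hY
  have hinv : 1 ≤ 1 / α := (one_le_div hα).2 hα1
  have hαy : (1 / α) ^ d ≤ y := by
    rcases d.eq_zero_or_pos with rfl | hd
    · simp [hy]
    · have : (1 : ℝ) ≤ d := by exact_mod_cast hd
      rw [hy]
      gcongr
  have hy1 : 1 ≤ y := (one_le_pow₀ hinv).trans hαy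
  have hnY : (n : ℝ) ≤ Y := le_mul_of_one_le_right (by positivity) hy1
  have hyY : y ≤ Y := le_mul_of_one_le_left (by positivity) (by linarith)
  have h2Y : (2 : ℝ) ^ d ≤ Y := by
    rcases Nat.lt_or_ge d 2 with hd | hd
    · interval_cases d
      · linarith
      · linarith
    · refine le_trans ?_ hyY
      have h2d : (2 : ℝ) ≤ d := by exact_mod_cast hd
      have : (2 : ℝ) ≤ d / α := h2d.trans (le_div_self (by positivity) hα hα1)
      rw [hy]
      gcongr
  -- The radius bound `α ≤ 2 / n` lets `1 / α` absorb `n`.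
  have hndY : (n : ℝ) ^ d ≤ Y ^ 2 := by
    have h1 : (n : ℝ) ≤ 2 * (1 / α) := by
      rw [mul_one_div, le_div_iff₀ hα]
      rw [le_div_iff₀ (by positivity)] at hα2
      linarith
    calc (n : ℝ) ^ d ≤ (2 * (1 / α)) ^ d := by gcongr
      _ = 2 ^ d * (1 / α) ^ d := mul_pow _ _ _
      _ ≤ Y * Y := mul_le_mul h2Y (hαy.trans hyY) (by positivity) (by positivity)
      _ = Y ^ 2 := by ring
  have hdY : (2 * d + 1 : ℝ) ≤ 2 * Y := by
    have : 2 * d + 1 ≤ 2 * 2 ^ d := by have := Nat.lt_two_pow_self (n := d); omega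
    have : (2 * d + 1 : ℝ) ≤ 2 * 2 ^ d := by exact_mod_cast this
    linarith
  have hDY : (2 * d / α) ^ (2 * d) ≤ Y ^ 4 := by
    calc (2 * d / α) ^ (2 * d) = (2 ^ d) ^ 2 * y ^ 2 := by
          rw [hy, mul_div_assoc, mul_pow, mul_comm 2 d, pow_mul, pow_mul]
      _ ≤ Y ^ 2 * Y ^ 2 := by gcongr
      _ = Y ^ 4 := by ring
  have hd0 : 0 < (2 * d / α) ^ (2 * d) := by
    rcases d.eq_zero_or_pos with rfl | hd
    · simp
    · positivity
  have hY0 : 0 < Y := by positivity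
  have hYinv : (2 : ℝ) ≤ Y := hn2'.trans hnY
  -- Extrapolation costs at most `2 * Y ^ 8`. The query condition costs `Y ^ 9` on one side and `Y ^
  -- 16` from `γ ^ 2` on the other, whence the exponent `25`; `2500` exceeds `4 * 576`.
  let γ : ℝ := ε / (2 * Y ^ 8)
  have hγ0 : 0 < γ := by positivity
  have hγ1 : γ ≤ 1 := by
    rw [div_le_one (by positivity)]
    have : 1 ≤ Y ^ 8 := one_le_pow₀ (by linarith)
    linarith
  obtain ⟨next, hV, hclose⟩ := exists_next_of_isPolynomialModel hn hlam' hα hsub hpoly hβB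
    (by positivity) hγ0 hγ1 (by
      calc 576 * ((n : ℝ) ^ d) ^ 3 * n ^ 3 * (1 / 2500 * ε ^ 2 / Y ^ 25)
          ≤ 576 * (Y ^ 2) ^ 3 * Y ^ 3 * (1 / 2500 * ε ^ 2 / Y ^ 25) := by gcongr
        _ = 576 / 2500 * ε ^ 2 / Y ^ 16 := by field_simp
        _ < 1 / 4 * ε ^ 2 / Y ^ 16 :=
          div_lt_div_of_pos_right (by nlinarith [pow_pos hε 2]) (by positivity)
        _ = γ ^ 2 := by simp only [γ]; field_simp; norm_num)
  refine ⟨next, hV, fun ans M hM M' hM' x => ?_⟩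
  refine (norm_toLp_le_mul_of_abs_le
    (B := (2 * d + 1) * (2 * d / α) ^ (2 * d) * (γ * n ^ 2)) (by positivity) fun i =>
      abs_normScore_sub_le_of_localBall hn hα hα1 hlam' (hpoly M (mem_of_mem_versionSpace hM))
        (hpoly M' (mem_of_mem_versionSpace hM')) hsub i
        (fun v hv => hclose ans M hM M' hM' v hv i) x).trans ?_
  calc n * ((2 * d + 1) * (2 * d / α) ^ (2 * d) * (γ * n ^ 2))
      ≤ Y * (2 * Y * Y ^ 4 * (γ * Y ^ 2)) := by gcongr
    _ = ε := by
        simp only [γ]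
        field_simp

theorem mainTheorem8 :
    (∃ (C p : ℕ) (c : ℝ), 0 < c ∧
      ∀ (n d k : ℕ) (lam : ℝ), 1 ≤ n → 1 ≤ k → (k : ℝ) ^ 2 / n ≤ lam → lam ≤ 1 →
        IsLocallyLearnableAround k (C * n ^ d) (classBMLP n d lam) (uniformVector n)
          (fun ε α => c * ε ^ 2 / ((n : ℝ) * ((d : ℝ) / α) ^ d) ^ p)) ∧
    (∃ (C : ℕ) (F : ℕ → ℕ → ℝ), (∀ n d, 0 < F n d) ∧
      ∀ (n d k : ℕ) (lam : ℝ), 1 ≤ n → 1 ≤ k → (k : ℝ) ^ 2 / n ≤ lam → lam ≤ 1 →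
        IsLocallyLearnableAround k (C * n ^ d) (classBNMP n d lam) (uniformVector n)
          (fun ε α => ε * α ^ d / F n d)) := by
  refine ⟨⟨3, 25, 1 / 2500, by norm_num, fun n d k lam => isLocallyLearnableAround_classBMLP⟩,
    ⟨1, fun n d => 2 * (n + 1) ^ (d + 1) * (d + 1) * d ^ d, fun n d => ?_,
      fun n d k lam => isLocallyLearnableAround_classBNMP⟩⟩
  rcases d.eq_zero_or_pos with rfl | hd
  · simp only [CharP.cast_eq_zero, pow_zero]
    positivity
  · positivity
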